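/- Let $G$ be a compact semisimple Lie group with Lie algebra $\mathfrak g$, let $\mathrm{Kil}$ be the negative of its Killing form, let $K\subseteq G$ be a closed subgroup with Lie algebra $\mathfrak k$, and let $\mathfrak m=\mathfrak k^{\perp}$ with respect to $\mathrm{Kil}$. Let $(G/K,g_0,J)$ be (homogeneous) almost Hermitian: $g_0$ is an $\mathrm{Ad}(K)$-invariant inner product on $\mathfrak m$, and $J$ is a linear operator on $\mathfrak m$ with $J^2=-1$ that is orthogonal for $g_0$ and commutes with $\mathrm{Ad}(K)$. Let $\mathfrak m_J$ be $\mathfrak m$ as a complex vector space via $iX=JX$, with the inner product $\langle X,Y\rangle_J=g_0(X,Y)+i\,g_0(JX,Y)$, linear in $Y$. Let $\mathcal S=\bigwedge^*\mathfrak m_J$ be its complex exterior algebra, with the inner product $\langle X_1\wedge\dots\wedge X_p,\,Y_1\wedge\dots\wedge Y_q\rangle=\delta_{pq}\det[\langle X_k,Y_l\rangle_J]$ and the action $\widetilde{\mathrm{Ad}}$ of $K$ by exterior-algebra automorphisms that extends $\mathrm{Ad}$ on $\mathfrak m_J$. For $X\in\mathfrak m$ let $\kappa(X)=i\,(a(X)+a^\dagger(X))$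 on $\mathcal S$, where $a^\dagger(X)$ is exterior multiplication by $X$ on the left and $a(X)(X_1\wedge\dots\wedge X_p)=\sum_j(-1)^{j-1}\langle X,X_j\rangle_J\,X_1\wedge\dots\wedge\widehat{X_j}\wedge\dots\wedge X_p$. Identify the vector fields on $G/K$ with $$\mathcal T(G/K)=\{V\in C^\infty(G,\mathfrak m): V(xs)=\mathrm{Ad}_s^{-1}(V(x)),\ x\in G,\ s\in K\},$$ and for a character $\chi:K\to U(1)$ set $$\mathcal S(G/K,\chi)=\{\psi\in C^\infty(G,\mathcal S): \psi(xs)=\bar\chi(s)\,\widetilde{\mathrm{Ad}}{}_s^{-1}(\psi(x)),\ x\in G,\ s\in K\}.$$ On both of these the canonical connection is $(\nabla^c_Vf)(x)=\frac{d}{dt}\big|_{t=0}f(x\exp(tV(x)))$, and the same formula defines the derivative $\delta_Vf$ of a smooth function $f$ on $G/K$. For $X\in\mathfrak m$ write $(\nabla^c_X\psi)(x)=\frac{d}{dt}\big|_{t=0}\psi(x\exp(tX))$. The Dirac operator of $\nabla^c$ is $$(D^{\nabla^c}\psi)(x)=\sum_j\kappa(Y_j)\big((\nabla^c_{Y_j}\psi)(x)\big)$$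 for any $g_0$-orthonormal basis $\{Y_j\}$ of $\mathfrak m$ (this does not depend on the basis). Then $\nabla^c$ maps $\mathcal T(G/K)\times\mathcal T(G/K)$ to $\mathcal T(G/K)$, is compatible with $g_0$, that is, $\delta_U(g_0(V,W))=g_0(\nabla^c_UV,W)+g_0(V,\nabla^c_UW)$, and commutes with $J$. For every character $\chi$ of $K$, and whether or not $\nabla^c$ has torsion, $D^{\nabla^c}$ maps $\mathcal S(G/K,\chi)$ to itself and is formally self-adjoint: $$\int_G\langle D^{\nabla^c}\psi,\varphi\rangle=\int_G\langle\psi,D^{\nabla^c}\varphi\rangle\qquad\text{for all }\psi,\varphi\in\mathcal S(G/K,\chi),$$ where the integrals are with respect to Haar measure on $G$ (this is the inner product of $L^2(G/K,\mathcal S)$). This applies in particular to coadjoint orbits with the Killing-form metric: let $\mu\in\mathfrak g'$, let $K$ be the stabilizer of $\mu$ for the coadjoint action, and let $\Gamma$ be the operator on $\mathfrak m$ with $\mu([X,Y])=\mathrm{Kil}(\Gamma X,Y)$ for $X,Y\in\mathfrak m$. Then the orthogonal factor $J$ of the polar decomposition $\Gamma=|\Gamma|J$ with respect to $\mathrm{Kil}$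 makes $(G/K,\mathrm{Kil}|_{\mathfrak m},J)$ almost Hermitian, and so for every character of $K$ its operator $D^{\nabla^c}$ maps $\mathcal S(G/K,\chi)$ to itself and is formally self-adjoint. -/

import Mathlib

open scoped Manifold ContDiff
open MeasureTheory

set_option linter.unusedSectionVars false

noncomputable section

namespace HomogeneousDirac

section Fock

variable {V : Type*} [NormedAddCommGroup V] [InnerProductSpace ℂ V] [FiniteDimensional ℂ V]

variable (V) in
/-- The Fock space of a finite-dimensional complex Hilbert space: its complex exterior algebra,
as a type of its own that will carry the inner product of the exterior algebra. -/
def Fock : Type _ := ExteriorAlgebra ℂ V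

instance fockAddCommGroup : AddCommGroup (Fock V) :=
  inferInstanceAs (AddCommGroup (ExteriorAlgebra ℂ V))

instance fockModule : Module ℂ (Fock V) :=
  inferInstanceAs (Module ℂ (ExteriorAlgebra ℂ V))

variable (V) in
/-- The identity map from the exterior algebra to the Fock space. -/
def toFock : ExteriorAlgebra ℂ V ≃ₗ[ℂ] Fock V := LinearEquiv.refl ℂ (ExteriorAlgebra ℂ V)

/-- The element `X₁ ∧ ⋯ ∧ Xₚ` of the Fock space. -/
def wedge {p : ℕ} (X : Fin p → V) : Fock V := toFock V (ExteriorAlgebra.ιMulti ℂ p X)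

variable (V) in
/-- The basis `e_I = e_{i₁} ∧ ⋯ ∧ e_{iₚ}`, `I = {i₁ < ⋯ < iₚ}`, of the Fock space that comes from an
orthonormal basis of `V`. -/
def fockBasis : Module.Basis (Finset (Fin (Module.finrank ℂ V))) ℂ (Fock V) :=
  (stdOrthonormalBasis ℂ V).toBasis.ExteriorAlgebra.map (toFock V)

/-- The inner product on the Fock space, conjugate linear in the first variable, for which the basis
`(e_I)` is orthonormal. It is the one with
`⟨X₁ ∧ ⋯ ∧ Xₚ, Y₁ ∧ ⋯ ∧ Y_q⟩ = δ_{pq} det ⟨X_k, Y_l⟩` (see `fock_inner_wedge` and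
`fock_inner_wedge_of_ne`), so it does not depend on the orthonormal basis of `V`. -/
@[reducible]
def fockCore : InnerProductSpace.Core ℂ (Fock V) where
  inner φ ψ := ∑ s, (starRingEnd ℂ) ((fockBasis V).repr φ s) * (fockBasis V).repr ψ s
  conj_inner_symm φ ψ := by simp [map_sum, mul_comm]
  add_left := by simp [add_mul, Finset.sum_add_distrib]
  smul_left := by simp [Finset.mul_sum, mul_assoc]
  re_inner_nonneg φ := by
    rw [map_sum]
    refine Finset.sum_nonneg fun s _ => ?_
    rw [mul_comm, RCLike.mul_conj]
    norm_cast
    positivity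
  definite φ h := by
    have h' : ∑ s, ‖(fockBasis V).repr φ s‖ ^ 2 = 0 := by
      have : ((∑ s, ‖(fockBasis V).repr φ s‖ ^ 2 : ℝ) : ℂ) = 0 := by
        rw [← h]
        push_cast
        refine Finset.sum_congr rfl fun s _ => ?_
        rw [mul_comm, Complex.mul_conj']
      exact_mod_cast this
    rw [Finset.sum_eq_zero_iff_of_nonneg (fun _ _ => by positivity)] at h'
    apply (fockBasis V).ext_elem
    intro s
    simpa using h' s (Finset.mem_univ s)

instance fockNormedAddCommGroup : NormedAddCommGroup (Fock V) := fockCore.toNormedAddCommGroup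

instance fockInnerProductSpace : InnerProductSpace ℂ (Fock V) := InnerProductSpace.ofCore _

theorem fock_inner_def (φ ψ : Fock V) : inner ℂ φ ψ =
    ∑ s, (starRingEnd ℂ) ((fockBasis V).repr φ s) * (fockBasis V).repr ψ s := rfl

theorem fockBasis_repr (p : ℕ) (x : ⋀[ℂ]^p V) (s : Finset (Fin (Module.finrank ℂ V))) :
    (fockBasis V).repr (toFock V x) s =
      if hs : s.card = p then
        exteriorPower.ιMultiDual ℂ p (stdOrthonormalBasis ℂ V).toBasis
          (Set.powersetCard.ofCard hs) x
      else 0 := by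
  set b := (stdOrthonormalBasis ℂ V).toBasis with hb
  have hx : toFock V x = ∑ t, ((b.exteriorPower p).repr x t) • fockBasis V t.1 := by
    conv_lhs => rw [← (b.exteriorPower p).sum_repr x]
    push_cast
    rw [map_sum]
    refine Finset.sum_congr rfl fun t _ => ?_
    rw [fockBasis, ← hb, map_smul, Module.Basis.map_apply, ExteriorAlgebra.basis_eq_coe_basis]
  rw [hx, map_sum, Finsupp.finsetSum_apply]
  simp only [map_smul, Module.Basis.repr_self, Finsupp.smul_apply, smul_eq_mul,
    Finsupp.single_apply, mul_ite, mul_one, mul_zero]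
  split_ifs with hs
  · rw [Finset.sum_eq_single (Set.powersetCard.ofCard hs)]
    · simp [exteriorPower.basis_repr_apply]
    · intro t _ ht
      rw [if_neg]
      rintro rfl
      exact ht rfl
    · simp
  · refine Finset.sum_eq_zero fun t _ => ?_
    rw [if_neg]
    rintro rfl
    exact hs t.2

theorem fock_inner_wedge {p : ℕ} (X Y : Fin p → V) :
    inner ℂ (wedge X) (wedge Y) = Matrix.det (Matrix.of fun k l => inner ℂ (X k) (Y l)) := by
  set b := (stdOrthonormalBasis ℂ V).toBasis with hb
  let f : Fin p → Module.Dual ℂ V := fun k => innerₛₗ ℂ (X k)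
  let L : Module.Dual ℂ (⋀[ℂ]^p V) :=
    exteriorPower.pairingDual ℂ V p (exteriorPower.ιMulti ℂ p f)
  let M : Module.Dual ℂ (⋀[ℂ]^p V) :=
    (innerₛₗ ℂ (wedge X)).comp ((toFock V).toLinearMap.comp (Submodule.subtype _))
  have key : M = L := by
    refine (b.exteriorPower p).ext fun s => ?_
    have h1 : M (b.exteriorPower p s) =
        (starRingEnd ℂ) ((fockBasis V).repr (wedge X) s.1) := by
      change inner ℂ (wedge X) (toFock V (b.exteriorPower p s : ⋀[ℂ]^p V)) = _
      rw [fock_inner_def, ← ExteriorAlgebra.basis_eq_coe_basis]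
      change ∑ t, _ * (fockBasis V).repr (fockBasis V s.1) t = _
      simp [Finsupp.single_apply]
    have h2 : wedge X = toFock V (exteriorPower.ιMulti ℂ p X : ⋀[ℂ]^p V) := rfl
    have hs : s.1.card = p := s.2
    rw [h1, h2, fockBasis_repr, dif_pos hs, exteriorPower.basis_apply,
      exteriorPower.ιMulti_family]
    simp only [L, exteriorPower.pairingDual_ιMulti_ιMulti,
      exteriorPower.ιMultiDual_apply_ιMulti, Set.powersetCard.ofCard_coe]
    rw [← Matrix.det_transpose, RingHom.map_det]
    congr 1
    ext i j
    simp [f, b, OrthonormalBasis.repr_apply_apply]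
  have h := LinearMap.congr_fun key (exteriorPower.ιMulti ℂ p Y)
  have h3 : M (exteriorPower.ιMulti ℂ p Y) = inner ℂ (wedge X) (wedge Y) := rfl
  rw [← h3, h]
  simp only [L, exteriorPower.pairingDual_ιMulti_ιMulti]
  rw [← Matrix.det_transpose]
  rfl

theorem fock_inner_wedge_of_ne {p q : ℕ} (hpq : p ≠ q) (X : Fin p → V) (Y : Fin q → V) :
    inner ℂ (wedge X) (wedge Y) = 0 := by
  have h2 : wedge X = toFock V (exteriorPower.ιMulti ℂ p X : ⋀[ℂ]^p V) := rfl
  have h3 : wedge Y = toFock V (exteriorPower.ιMulti ℂ q Y : ⋀[ℂ]^q V) := rfl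
  rw [h2, h3, fock_inner_def]
  refine Finset.sum_eq_zero fun s _ => ?_
  rw [fockBasis_repr, fockBasis_repr]
  by_cases hs : s.card = p
  · rw [dif_neg (fun h => hpq (hs.symm.trans h)), mul_zero]
  · rw [dif_neg hs, map_zero, zero_mul]

/-- The annihilation operator
`X₁ ∧ ⋯ ∧ Xₚ ↦ ∑ⱼ (-1)^(j-1) ⟨X, Xⱼ⟩ X₁ ∧ ⋯ ∧ (omit Xⱼ) ∧ ⋯ ∧ Xₚ`, that is, the contraction
with the linear form `⟨X, ·⟩`. -/
def annihilation (X : V) : Fock V →ₗ[ℂ] Fock V :=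
  (toFock V).conj (CliffordAlgebra.contractLeft (Q := (0 : QuadraticForm ℂ V)) (innerₛₗ ℂ X))

/-- The creation operator `X₁ ∧ ⋯ ∧ Xₚ ↦ X ∧ X₁ ∧ ⋯ ∧ Xₚ`. -/
def creation (X : V) : Fock V →ₗ[ℂ] Fock V :=
  (toFock V).conj (LinearMap.mulLeft ℂ (ExteriorAlgebra.ι ℂ X))

/-- The Clifford action `κ(X) = i (a(X) + a†(X))` of vectors on the Fock space. It is only
real-linear in `X`, and `κ(X) κ(Y) + κ(Y) κ(X) = -2 Re ⟨X, Y⟩`. -/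
def clifford (X : V) : Fock V →ₗ[ℂ] Fock V :=
  Complex.I • (annihilation X + creation X)

/-- The action on the Fock space, by exterior-algebra homomorphisms, of a linear map of `V`:
`X₁ ∧ ⋯ ∧ Xₚ ↦ R X₁ ∧ ⋯ ∧ R Xₚ`. -/
def fockMap (R : V →ₗ[ℂ] V) : Fock V →ₗ[ℂ] Fock V :=
  (toFock V).conj (ExteriorAlgebra.map R).toLinearMap

theorem clifford_apply (X : V) (φ : Fock V) : clifford X φ = toFock V (Complex.I •
    (CliffordAlgebra.contractLeft (Q := (0 : QuadraticForm ℂ V)) (innerₛₗ ℂ X)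
        ((toFock V).symm φ) +
      ExteriorAlgebra.ι ℂ X * (toFock V).symm φ)) := rfl

theorem clifford_add (X Y : V) (φ : Fock V) :
    clifford (X + Y) φ = clifford X φ + clifford Y φ := by
  simp only [clifford_apply, map_add, LinearMap.add_apply, add_mul, smul_add]
  abel

theorem clifford_smul (r : ℝ) (X : V) (φ : Fock V) : clifford (r • X) φ = r • clifford X φ := by
  have h1 : r • X = (r : ℂ) • X := (Complex.coe_smul r X).symm
  have h2 : r • clifford X φ = (r : ℂ) • clifford X φ := (Complex.coe_smul r _).symm
  rw [h1, h2]
  simp only [clifford_apply, LinearMap.map_smulₛₗ, map_smul, map_add, Complex.conj_ofReal,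
    smul_add, smul_mul_assoc, LinearMap.smul_apply]
  simp only [smul_smul, mul_comm]

/-- The Clifford contraction of a real-linear map `T : V → Fock V`: transport `T`, seen in
`V* ⊗ Fock V`, to `V ⊗ Fock V` by the real inner product `Re ⟨·, ·⟩`, then apply the Clifford action.
In terms of the orthonormal real basis `(eⱼ, i eⱼ)`, with `(eⱼ)` a complex orthonormal basis, this is
the sum below; by `cliffordContraction_eq` it is `∑ⱼ κ(wⱼ) (T wⱼ)` for every frame `w` of `V`, so
nothing depends on the choice of the basis. -/
def cliffordContraction (T : V →ₗ[ℝ] Fock V) : Fock V :=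
  ∑ j, (clifford (stdOrthonormalBasis ℂ V j) (T (stdOrthonormalBasis ℂ V j)) +
    clifford (Complex.I • stdOrthonormalBasis ℂ V j) (T (Complex.I • stdOrthonormalBasis ℂ V j)))

theorem frame_sum_eq {ι ι' : Type*} [Fintype ι] [Fintype ι'] (w : ι → V) (u : ι' → V)
    (hw : ∀ v : V, v = ∑ j, (inner ℂ (w j) v : ℂ).re • w j)
    (hu : ∀ v : V, v = ∑ j, (inner ℂ (u j) v : ℂ).re • u j) (T : V →ₗ[ℝ] Fock V) :
    ∑ j, clifford (w j) (T (w j)) = ∑ k, clifford (u k) (T (u k)) := by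
  let κ : V →ₗ[ℝ] Fock V →ₗ[ℝ] Fock V := LinearMap.mk₂ ℝ (fun X φ => clifford X φ)
    (fun X Y φ => clifford_add X Y φ) (fun r X φ => clifford_smul r X φ)
    (fun X φ φ' => map_add _ _ _)
    (fun r X φ => by
      rw [← Complex.coe_smul, map_smul, Complex.coe_smul])
  have hre : ∀ x y : V, (inner ℂ x y : ℂ).re = (inner ℂ y x : ℂ).re := fun x y => by
    rw [← inner_conj_symm, Complex.conj_re]
  have e : ∀ j, clifford (w j) (T (w j)) = ∑ k, ∑ l,
      ((inner ℂ (u k) (w j) : ℂ).re * (inner ℂ (w j) (u l) : ℂ).re) • κ (u k) (T (u l)) := by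
    intro j
    change κ (w j) (T (w j)) = _
    conv_lhs => rw [hu (w j)]
    simp only [map_sum, map_smul, LinearMap.sum_apply, LinearMap.smul_apply, smul_smul,
      hre (w j), Finset.smul_sum]
    rw [Finset.sum_comm]
    refine Finset.sum_congr rfl fun k _ => Finset.sum_congr rfl fun l _ => ?_
    rw [mul_comm]
  simp only [e]
  rw [Finset.sum_comm]
  refine Finset.sum_congr rfl fun k _ => ?_
  rw [Finset.sum_comm]
  have h : ∀ l, ∑ j, ((inner ℂ (u k) (w j) : ℂ).re * (inner ℂ (w j) (u l) : ℂ).re) =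
      (inner ℂ (u l) (u k) : ℂ).re := by
    intro l
    have h := congrArg (fun v => (inner ℂ (u k) v : ℂ).re) (hw (u l))
    simp only [inner_sum, ← Complex.coe_smul, inner_smul_right, Complex.re_sum,
      Complex.re_ofReal_mul] at h
    rw [hre, h]
    exact Finset.sum_congr rfl fun j _ => mul_comm _ _
  simp only [← Finset.sum_smul, h]
  have hT : T (u k) = ∑ l, (inner ℂ (u l) (u k) : ℂ).re • T (u l) := by
    conv_lhs => rw [hu (u k)]
    simp only [map_sum, map_smul]
  change _ = κ (u k) (T (u k))
  rw [hT]
  simp only [map_sum, map_smul]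

theorem cliffordContraction_eq {ι : Type*} [Fintype ι] (w : ι → V)
    (hw : ∀ v : V, v = ∑ j, (inner ℂ (w j) v : ℂ).re • w j) (T : V →ₗ[ℝ] Fock V) :
    cliffordContraction T = ∑ j, clifford (w j) (T (w j)) := by
  set b := stdOrthonormalBasis ℂ V with hb
  let u : Fin (Module.finrank ℂ V) ⊕ Fin (Module.finrank ℂ V) → V :=
    Sum.elim b (fun j => Complex.I • b j)
  have hu : ∀ v : V, v = ∑ j, (inner ℂ (u j) v : ℂ).re • u j := by
    intro v
    rw [Fintype.sum_sum_type, ← Finset.sum_add_distrib]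
    conv_lhs => rw [← b.sum_repr' v]
    refine Finset.sum_congr rfl fun j _ => ?_
    simp only [u, Sum.elim_inl, Sum.elim_inr, inner_smul_left, ← Complex.coe_smul, smul_smul,
      ← add_smul]
    congr 1
    apply Complex.ext <;> simp
  rw [frame_sum_eq w u hw hu, Fintype.sum_sum_type, ← Finset.sum_add_distrib]
  rfl

end Fock

section LieGroup

variable {n : ℕ} {G : Type*} [TopologicalSpace G] [ChartedSpace (EuclideanSpace ℝ (Fin n)) G]
  [Group G]

instance leInfty_minSmoothness : ENat.LEInfty (minSmoothness ℝ 3) :=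
  ⟨by rw [minSmoothness_of_isRCLikeNormedField]; exact ENat.LEInfty.out⟩

variable (n G) in
/-- The Lie algebra `𝔤` of an `n`-dimensional Lie group. -/
abbrev LieAlg : Type := GroupLieAlgebra (𝓡 n) G

instance : FiniteDimensional ℝ (LieAlg n G) :=
  inferInstanceAs (FiniteDimensional ℝ (EuclideanSpace ℝ (Fin n)))

variable [LieGroup (𝓡 n) ∞ G]

variable (n) in
/-- The adjoint action of `G` on `𝔤`: the derivative at `1` of `y ↦ x y x⁻¹`. -/
def Ad (x : G) : LieAlg n G →ₗ[ℝ] LieAlg n G :=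
  (mfderiv (𝓡 n) (𝓡 n) (fun y : G => x * y * x⁻¹) 1).toLinearMap

theorem contMDiff_conj (x : G) : ContMDiff (𝓡 n) (𝓡 n) ∞ (fun y : G => x * y * x⁻¹) :=
  (contMDiff_const.mul contMDiff_id).mul contMDiff_const

theorem mdifferentiableAt_conj (x y : G) :
    MDifferentiableAt (𝓡 n) (𝓡 n) (fun y : G => x * y * x⁻¹) y :=
  (contMDiff_conj x).mdifferentiableAt (by simp)

/-- The derivative of a map `G → G`, with the tangent spaces unfolded to the model space. -/
def rawDeriv (f : G → G) (x : G) : EuclideanSpace ℝ (Fin n) →L[ℝ] EuclideanSpace ℝ (Fin n) :=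
  mfderiv (𝓡 n) (𝓡 n) f x

theorem rawDeriv_id (x : G) : rawDeriv (n := n) (fun y : G => y) x = ContinuousLinearMap.id ℝ _ :=
  mfderiv_id (I := 𝓡 n) (x := x)

theorem rawDeriv_comp {f g : G → G} {x : G} (hf : MDifferentiableAt (𝓡 n) (𝓡 n) f (g x))
    (hg : MDifferentiableAt (𝓡 n) (𝓡 n) g x) :
    rawDeriv (n := n) (fun y => f (g y)) x = (rawDeriv f (g x)).comp (rawDeriv g x) :=
  mfderiv_comp x hf hg

theorem Ad_apply (x : G) (X : LieAlg n G) :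
    Ad n x X = rawDeriv (n := n) (fun y : G => x * y * x⁻¹) 1 X := rfl

theorem Ad_one : Ad n (1 : G) = LinearMap.id := by
  have h : (fun y : G => 1 * y * 1⁻¹) = fun y => y := by ext; simp
  refine LinearMap.ext fun X => ?_
  rw [Ad_apply, h, rawDeriv_id]
  rfl

theorem Ad_mul (x y : G) : Ad n (x * y) = Ad n x ∘ₗ Ad n y := by
  have h : (fun z : G => x * y * z * (x * y)⁻¹) =
      (fun z : G => x * (y * z * y⁻¹) * x⁻¹) := by
    ext z; simp [mul_assoc]
  refine LinearMap.ext fun X => ?_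
  rw [LinearMap.comp_apply, Ad_apply, Ad_apply, Ad_apply, h,
    rawDeriv_comp (f := fun z : G => x * z * x⁻¹) (g := fun z : G => y * z * y⁻¹)
      (mdifferentiableAt_conj x _) (mdifferentiableAt_conj y _)]
  have h1 : y * 1 * y⁻¹ = 1 := by simp
  rw [h1]
  rfl

theorem Ad_inv_Ad (x : G) (X : LieAlg n G) : Ad n x⁻¹ (Ad n x X) = X := by
  have := LinearMap.congr_fun (Ad_mul (n := n) x⁻¹ x) X
  rw [inv_mul_cancel, Ad_one] at this
  exact this.symm

theorem Ad_Ad_inv (x : G) (X : LieAlg n G) : Ad n x (Ad n x⁻¹ X) = X := by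
  have := Ad_inv_Ad x⁻¹ X
  rwa [inv_inv] at this

theorem rawDeriv_conj_inverse (x y : G) :
    (rawDeriv (n := n) (fun z : G => x * z * x⁻¹) y).inverse =
      rawDeriv (n := n) (fun z : G => x⁻¹ * z * x⁻¹⁻¹) (x * y * x⁻¹) := by
  refine ContinuousLinearMap.inverse_eq ?_ ?_
  · have h : (fun z : G => x * (x⁻¹ * z * x⁻¹⁻¹) * x⁻¹) = fun z => z := by
      ext z; simp [mul_assoc]
    have h' := rawDeriv_comp (n := n) (f := fun z : G => x * z * x⁻¹)
      (g := fun z : G => x⁻¹ * z * x⁻¹⁻¹) (x := x * y * x⁻¹)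
      (mdifferentiableAt_conj x _) (mdifferentiableAt_conj x⁻¹ _)
    have hy : x⁻¹ * (x * y * x⁻¹) * x⁻¹⁻¹ = y := by simp [mul_assoc]
    rw [h, rawDeriv_id, hy] at h'
    exact h'.symm
  · have h : (fun z : G => x⁻¹ * (x * z * x⁻¹) * x⁻¹⁻¹) = fun z => z := by
      ext z; simp [mul_assoc]
    have h' := rawDeriv_comp (n := n) (f := fun z : G => x⁻¹ * z * x⁻¹⁻¹)
      (g := fun z : G => x * z * x⁻¹) (x := y)
      (mdifferentiableAt_conj x⁻¹ _) (mdifferentiableAt_conj x _)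
    rw [h, rawDeriv_id] at h'
    exact h'.symm

theorem mdifferentiableAt_mulLeft (x y : G) :
    MDifferentiableAt (𝓡 n) (𝓡 n) (fun z : G => x * z) y :=
  (contMDiff_mul_left (I := 𝓡 n) (n := ∞) (a := x)).mdifferentiableAt (by simp)

theorem mpullback_conj (x : G) (v : LieAlg n G) :
    VectorField.mpullback (𝓡 n) (𝓡 n) (fun y : G => x * y * x⁻¹)
      (mulInvariantVectorField (Ad n x v)) = mulInvariantVectorField v := by
  funext y
  have hA : (fun z : G => x * y * x⁻¹ * (x * z * x⁻¹)) = fun z => x * (y * z) * x⁻¹ := by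
    ext z; simp [mul_assoc]
  have h1 := rawDeriv_comp (n := n) (f := fun z : G => x * y * x⁻¹ * z)
    (g := fun z : G => x * z * x⁻¹) (x := 1) (mdifferentiableAt_mulLeft _ _)
    (mdifferentiableAt_conj x _)
  have h2 := rawDeriv_comp (n := n) (f := fun z : G => x * z * x⁻¹)
    (g := fun z : G => y * z) (x := 1) (mdifferentiableAt_conj x _)
    (mdifferentiableAt_mulLeft _ _)
  rw [hA, h2] at h1
  have e1 : x * 1 * x⁻¹ = 1 := by simp
  rw [e1, mul_one] at h1
  have h3 : (rawDeriv (n := n) (fun z : G => x * z * x⁻¹) y).inverse.comp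
      (rawDeriv (n := n) (fun z : G => x * z * x⁻¹) y) = ContinuousLinearMap.id ℝ _ := by
    rw [rawDeriv_conj_inverse, ← rawDeriv_comp (mdifferentiableAt_conj x⁻¹ _)
      (mdifferentiableAt_conj x _)]
    have h : (fun z : G => x⁻¹ * (x * z * x⁻¹) * x⁻¹⁻¹) = fun z => z := by
      ext z; simp [mul_assoc]
    rw [h, rawDeriv_id]
  change (rawDeriv (n := n) (fun z : G => x * z * x⁻¹) y).inverse
    (rawDeriv (n := n) (fun z : G => x * y * x⁻¹ * z) 1
      (rawDeriv (n := n) (fun z : G => x * z * x⁻¹) 1 v)) =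
    rawDeriv (n := n) (fun z : G => y * z) 1 v
  have h4 := congrArg (fun A => A v) h1
  have h5 := congrArg (fun A => A (rawDeriv (n := n) (fun z : G => y * z) 1 v)) h3
  exact (congrArg _ h4.symm).trans h5

theorem Ad_lie (x : G) (X Y : LieAlg n G) : Ad n x ⁅X, Y⁆ = ⁅Ad n x X, Ad n x Y⁆ := by
  have h := VectorField.mpullback_mlieBracket (I := 𝓡 n) (I' := 𝓡 n) (n := minSmoothness ℝ 3)
    (f := fun y : G => x * y * x⁻¹) (V := mulInvariantVectorField (Ad n x X))
    (W := mulInvariantVectorField (Ad n x Y)) (x₀ := 1)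
    (mdifferentiableAt_mulInvariantVectorField _) (mdifferentiableAt_mulInvariantVectorField _)
    ((contMDiff_conj x).of_le ENat.LEInfty.out).contMDiffAt (minSmoothness_monotone (by norm_cast))
  rw [mpullback_conj, mpullback_conj] at h
  have e1 : x * 1 * x⁻¹ = 1 := by simp
  have h' : (rawDeriv (n := n) (fun z : G => x * z * x⁻¹) 1).inverse
      (⁅Ad n x X, Ad n x Y⁆ : LieAlg n G) =
      ⁅X, Y⁆ := by
    rw [GroupLieAlgebra.bracket_def X Y, ← h]
    change _ = (rawDeriv (n := n) (fun z : G => x * z * x⁻¹) 1).inverse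
      (VectorField.mlieBracket (𝓡 n) (mulInvariantVectorField (Ad n x X))
        (mulInvariantVectorField (Ad n x Y)) (x * 1 * x⁻¹))
    rw [e1]
    rfl
  rw [← h', rawDeriv_conj_inverse, e1]
  exact Ad_Ad_inv x _

/-- `Ad x` as an automorphism of the Lie algebra. -/
def AdEquiv (x : G) : LieAlg n G ≃ₗ⁅ℝ⁆ LieAlg n G where
  toLinearMap := Ad n x
  map_lie' := Ad_lie x _ _
  invFun := Ad n x⁻¹
  left_inv := Ad_inv_Ad x
  right_inv := Ad_Ad_inv x

variable (n G) in
/-- `Kil`, the negative of the Killing form. -/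
def Kil : LinearMap.BilinForm ℝ (LieAlg n G) := -killingForm ℝ (LieAlg n G)

theorem Kil_Ad (x : G) (X Y : LieAlg n G) : Kil n G (Ad n x X) (Ad n x Y) = Kil n G X Y :=
  congrArg Neg.neg (LieAlgebra.killingForm_of_equiv_apply (AdEquiv x) X Y)

/-- The Lie algebra `𝔨` of a closed subgroup `K`: the velocities of the one-parameter subgroups of
`G` that run in `K`, in other words the `X ∈ 𝔤` with `exp (t X) ∈ K` for all real `t`. -/
def subgroupLieAlg (n : ℕ) {G : Type*} [TopologicalSpace G]
    [ChartedSpace (EuclideanSpace ℝ (Fin n)) G] [Group G] (K : Subgroup G) : Set (LieAlg n G) :=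
  {X | ∃ γ : ℝ → G, ContMDiff 𝓘(ℝ, ℝ) (𝓡 n) ∞ γ ∧ (∀ s t, γ (s + t) = γ s * γ t) ∧
    (∀ t, γ t ∈ K) ∧ (mfderiv 𝓘(ℝ, ℝ) (𝓡 n) γ 0 (1 : ℝ) : EuclideanSpace ℝ (Fin n)) = X}

theorem Ad_mem_subgroupLieAlg {K : Subgroup G} {s : G} (hs : s ∈ K) {X : LieAlg n G}
    (hX : X ∈ subgroupLieAlg n K) : Ad n s X ∈ subgroupLieAlg n K := by
  obtain ⟨γ, hγ, hmul, hK, hd⟩ := hX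
  have h0 : γ 0 = 1 := by simpa using hmul 0 0
  refine ⟨fun t => s * γ t * s⁻¹, (contMDiff_conj s).comp hγ, fun a b => ?_, fun t =>
    K.mul_mem (K.mul_mem hs (hK t)) (K.inv_mem hs), ?_⟩
  · simp [hmul, mul_assoc]
  · have h := mfderiv_comp (I := 𝓘(ℝ, ℝ)) (I' := 𝓡 n) (I'' := 𝓡 n) (g := fun y : G => s * y * s⁻¹)
      (f := γ) (0 : ℝ) (mdifferentiableAt_conj s _) (hγ.mdifferentiableAt (by simp))
    have h' := congrArg (fun A : ℝ →L[ℝ] EuclideanSpace ℝ (Fin n) => A 1) h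
    refine h'.trans ?_
    change rawDeriv (n := n) (fun y : G => s * y * s⁻¹) (γ 0) _ = _
    rw [h0, Ad_apply]
    exact congrArg _ hd

variable (n) in
/-- `𝔪`, the orthogonal complement of `𝔨` for `Kil`. -/
def tangentM (K : Subgroup G) : Submodule ℝ (LieAlg n G) where
  carrier := {X | ∀ Y ∈ subgroupLieAlg n K, Kil n G Y X = 0}
  add_mem' hX hX' Y hY := by rw [map_add, hX Y hY, hX' Y hY, add_zero]
  zero_mem' Y _ := map_zero _
  smul_mem' r X hX Y hY := by rw [map_smul, hX Y hY, smul_zero]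

theorem Ad_mem_tangentM {K : Subgroup G} {s : G} (hs : s ∈ K) {X : LieAlg n G}
    (hX : X ∈ tangentM n K) : Ad n s X ∈ tangentM n K := by
  intro Y hY
  rw [← Ad_Ad_inv s Y, Kil_Ad]
  exact hX _ (Ad_mem_subgroupLieAlg (K.inv_mem hs) hY)

/-- The adjoint action of `K` on `𝔪`. -/
def AdM {K : Subgroup G} (s : K) : tangentM n K →ₗ[ℝ] tangentM n K :=
  (Ad n (s : G)).restrict fun _ hX => Ad_mem_tangentM s.2 hX

variable (n) in
/-- A homogeneous almost-Hermitian structure on `G/K`: an `Ad(K)`-invariant inner product `g₀` on `𝔪`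
and a complex structure `J` on `𝔪` that is orthogonal for `g₀` and commutes with `Ad(K)`. -/
structure AlmostHermitian (K : Subgroup G) where
  g₀ : LinearMap.BilinForm ℝ (tangentM n K)
  g₀_symm : ∀ X Y, g₀ X Y = g₀ Y X
  g₀_pos : ∀ X, X ≠ 0 → 0 < g₀ X X
  g₀_Ad : ∀ (s : K) (X Y), g₀ (AdM s X) (AdM s Y) = g₀ X Y
  J : tangentM n K →ₗ[ℝ] tangentM n K
  J_J : ∀ X, J (J X) = -X
  g₀_J : ∀ X Y, g₀ (J X) (J Y) = g₀ X Y
  J_Ad : ∀ (s : K) (X), J (AdM s X) = AdM s (J X)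

/-- The derivative `D₀ᵗ f (x exp (t X))` of a vector-valued function `f` on `G`: the derivative at
the identity, in the direction `X`, of `y ↦ f (x y)`. -/
def derivAlong {F : Type*} [NormedAddCommGroup F] [NormedSpace ℝ F] (f : G → F) (x : G)
    (X : LieAlg n G) : F :=
  mfderiv (𝓡 n) 𝓘(ℝ, F) (fun y => f (x * y)) 1 X

namespace AlmostHermitian

variable {K : Subgroup G} (h : AlmostHermitian n K)

/-- `𝔪_J`: the space `𝔪` as a complex vector space through `i X = J X`. -/
def MJ (_h : AlmostHermitian n K) : Type := tangentM n K

instance : AddCommGroup h.MJ := inferInstanceAs (AddCommGroup (tangentM n K))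

/-- The identity map `𝔪_J → 𝔪`. -/
def toM : h.MJ ≃+ tangentM n K := AddEquiv.refl _

instance : SMul ℂ h.MJ := ⟨fun z X => h.toM.symm (z.re • h.toM X + z.im • h.J (h.toM X))⟩

theorem toM_smul (z : ℂ) (X : h.MJ) :
    h.toM (z • X) = z.re • h.toM X + z.im • h.J (h.toM X) := rfl

instance : Module ℂ h.MJ where
  one_smul X := h.toM.injective (by simp [toM_smul])
  mul_smul z w X := h.toM.injective (by
    simp only [toM_smul, map_add, map_smul, J_J, Complex.mul_re, Complex.mul_im]
    module)
  smul_zero z := h.toM.injective (by simp [toM_smul])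
  smul_add z X Y := h.toM.injective (by
    simp only [toM_smul, map_add]
    module)
  add_smul z w X := h.toM.injective (by
    simp only [toM_smul, map_add, Complex.add_re, Complex.add_im]
    module)
  zero_smul X := h.toM.injective (by simp [toM_smul])

theorem g₀_J_left (X Y : tangentM n K) : h.g₀ X (h.J Y) = -h.g₀ (h.J X) Y := by
  have := h.g₀_J X (h.J Y)
  rw [J_J, map_neg] at this
  exact this.symm

/-- The complex inner product `⟨X, Y⟩_J = g₀(X, Y) + i g₀(J X, Y)` on `𝔪_J`. -/
@[reducible]
def core : InnerProductSpace.Core ℂ h.MJ where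
  inner X Y := ⟨h.g₀ (h.toM X) (h.toM Y), h.g₀ (h.J (h.toM X)) (h.toM Y)⟩
  conj_inner_symm X Y := by
    apply Complex.ext
    · simpa using h.g₀_symm _ _
    · have := h.g₀_J_left (h.toM Y) (h.toM X)
      simp only [Complex.conj_im]
      rw [← this, h.g₀_symm]
  add_left X Y Z := by apply Complex.ext <;> simp
  smul_left X Y z := by
    apply Complex.ext <;> simp [toM_smul, J_J]
  re_inner_nonneg X := by
    by_cases hX : h.toM X = 0
    · simp [hX]
    · exact (h.g₀_pos _ hX).le
  definite X hX := by
    by_contra hne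
    have hne' : h.toM X ≠ 0 := fun h0 => hne (h.toM.injective (by rw [h0, map_zero]))
    exact (h.g₀_pos _ hne').ne' (congrArg Complex.re hX)

instance : NormedAddCommGroup h.MJ := h.core.toNormedAddCommGroup

instance : InnerProductSpace ℂ h.MJ := InnerProductSpace.ofCore _

theorem toM_real_smul (r : ℝ) (X : h.MJ) : h.toM (r • X) = r • h.toM X := by
  rw [← Complex.coe_smul, toM_smul]
  simp

/-- The identity map `𝔪_J → 𝔪`, as a real-linear map. -/
def toMₗ : h.MJ ≃ₗ[ℝ] tangentM n K := { h.toM with map_smul' := h.toM_real_smul }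

instance : FiniteDimensional ℝ h.MJ := Module.Finite.equiv h.toMₗ.symm

instance : FiniteDimensional ℂ h.MJ := FiniteDimensional.right ℝ ℂ h.MJ

/-- The unitary action of `K` on `𝔪_J`. -/
def AdJ (s : K) : h.MJ →ₗ[ℂ] h.MJ where
  toFun X := h.toM.symm (AdM s (h.toM X))
  map_add' X Y := by simp
  map_smul' z X := h.toM.injective (by simp [toM_smul, h.J_Ad])

/-- The space `𝒮` of spinors. -/
abbrev Spinors : Type := Fock h.MJ

/-- The tangent vector fields on `G/K`, as functions on `G`. -/
def vectorFields : Set (G → h.MJ) :=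
  {V | ContMDiff (𝓡 n) 𝓘(ℝ, h.MJ) ∞ V ∧ ∀ (x : G) (s : K), V (x * s) = h.AdJ s⁻¹ (V x)}

/-- The spinor fields on `G/K` for `J` and the character `χ` of `K`, as functions on `G`. -/
def spinorFields (χ : K →ₜ* Circle) : Set (G → h.Spinors) :=
  {ψ | ContMDiff (𝓡 n) 𝓘(ℝ, h.Spinors) ∞ ψ ∧
    ∀ (x : G) (s : K), ψ (x * s) = (starRingEnd ℂ) (χ s : ℂ) • fockMap (h.AdJ s⁻¹) (ψ x)}

/-- The canonical connection `(∇ᶜ_V f)(x) = D₀ᵗ f (x exp (t V(x)))`, on vector fields and on spinor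
fields alike (and, for scalar functions, the derivation `δ_V`). -/
def canonicalConnection {F : Type*} [NormedAddCommGroup F] [NormedSpace ℝ F] (V : G → h.MJ)
    (f : G → F) (x : G) : F :=
  derivAlong f x (h.toM (V x) : LieAlg n G)

/-- The value at `x` of `dψ : V ↦ ∇ᶜ_V ψ`, as a real-linear map on the tangent space `𝔪`. -/
def differential (ψ : G → h.Spinors) (x : G) : h.MJ →ₗ[ℝ] h.Spinors where
  toFun X := h.canonicalConnection (fun _ => X) ψ x
  map_add' X Y := map_add (mfderiv (𝓡 n) 𝓘(ℝ, h.Spinors) (fun y => ψ (x * y)) 1) _ _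
  map_smul' r X := by
    have := h.toM_real_smul r X
    simp only [canonicalConnection, this]
    exact map_smul (mfderiv (𝓡 n) 𝓘(ℝ, h.Spinors) (fun y => ψ (x * y)) 1) _ _

/-- The Dirac operator of the canonical connection: `dψ` is turned into an element of
`𝒯(G/K) ⊗ 𝒮(G/K, χ)` by the metric `g₀`, and the Clifford action is applied to it. -/
def dirac (ψ : G → h.Spinors) (x : G) : h.Spinors :=
  cliffordContraction (h.differential ψ x)

/-- The inner product of two spinor fields in `L²(G/K, 𝒮)`, for the invariant measure on `G/K`
that is the image of the Haar measure `ν` on `G`. -/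
def innerL2 [MeasurableSpace G] (ν : Measure G) (ψ φ : G → h.Spinors) : ℂ :=
  ∫ x, inner ℂ (ψ x) (φ x) ∂ν

/-- A connection `∇` on the tangent bundle of `G/K` is compatible with `g₀`, in the sense of the
Leibniz rule `δ_U g₀(V, W) = g₀(∇_U V, W) + g₀(V, ∇_U W)`. -/
def CompatibleWithMetric (nabla : (G → h.MJ) → (G → h.MJ) → (G → h.MJ)) : Prop :=
  ∀ U ∈ h.vectorFields, ∀ V ∈ h.vectorFields, ∀ W ∈ h.vectorFields, ∀ x : G,
    h.canonicalConnection U (fun y => h.g₀ (h.toM (V y)) (h.toM (W y))) x =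
      h.g₀ (h.toM (nabla U V x)) (h.toM (W x)) + h.g₀ (h.toM (V x)) (h.toM (nabla U W x))

/-- A connection `∇` on the tangent bundle of `G/K` commutes with `J`. -/
def CommutesWithJ (nabla : (G → h.MJ) → (G → h.MJ) → (G → h.MJ)) : Prop :=
  ∀ V ∈ h.vectorFields, ∀ W ∈ h.vectorFields, ∀ x : G,
    nabla V (fun y => h.toM.symm (h.J (h.toM (W y)))) x =
      h.toM.symm (h.J (h.toM (nabla V W x)))

/-- Formal self-adjointness of an operator on the space `𝒮(G/K, χ)` of spinor fields. -/
def FormallySelfAdjoint [MeasurableSpace G] (ν : Measure G) (χ : K →ₜ* Circle)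
    (D : (G → h.Spinors) → (G → h.Spinors)) : Prop :=
  ∀ ψ ∈ h.spinorFields χ, ∀ φ ∈ h.spinorFields χ, h.innerL2 ν (D ψ) φ = h.innerL2 ν ψ (D φ)

end AlmostHermitian

/-- The stabilizer of `μ ∈ 𝔤'` for the coadjoint action `Ad'_x μ = μ ∘ Ad_{x⁻¹}`. -/
def coadjointStabilizer (μ : Module.Dual ℝ (LieAlg n G)) : Subgroup G where
  carrier := {x | μ ∘ₗ Ad n x⁻¹ = μ}
  one_mem' := by
    change μ ∘ₗ Ad n (1 : G)⁻¹ = μ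
    rw [inv_one, Ad_one, LinearMap.comp_id]
  mul_mem' {x y} hx hy := by
    change μ ∘ₗ Ad n (x * y)⁻¹ = μ
    rw [mul_inv_rev, Ad_mul, ← LinearMap.comp_assoc, show μ ∘ₗ Ad n y⁻¹ = μ from hy]
    exact hx
  inv_mem' {x} hx := by
    change μ ∘ₗ Ad n x⁻¹⁻¹ = μ
    refine LinearMap.ext fun X => ?_
    have := LinearMap.congr_fun (show μ ∘ₗ Ad n x⁻¹ = μ from hx) (Ad n x X)
    rw [LinearMap.comp_apply, Ad_inv_Ad] at this
    rw [inv_inv, LinearMap.comp_apply]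
    exact this.symm

/-- For the coadjoint orbit of `μ`, let `Γ` be the operator on `𝔪` with
`μ([X, Y]) = Kil(Γ X, Y)`. This says that `Γ = A J` with `A` symmetric and positive for `Kil`; when `J`
is orthogonal for `Kil`, it says that `J` is the orthogonal factor of the polar decomposition
`Γ = |Γ| J`. -/
def IsPolarFactor (μ : Module.Dual ℝ (LieAlg n G))
    (J : tangentM n (coadjointStabilizer μ) →ₗ[ℝ] tangentM n (coadjointStabilizer μ)) : Prop :=
  ∃ A : tangentM n (coadjointStabilizer μ) →ₗ[ℝ] tangentM n (coadjointStabilizer μ),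
    (∀ X Y : tangentM n (coadjointStabilizer μ), Kil n G (A X) Y = Kil n G X (A Y)) ∧
      (∀ X : tangentM n (coadjointStabilizer μ), X ≠ 0 → 0 < Kil n G (A X) X) ∧
      ∀ X Y : tangentM n (coadjointStabilizer μ),
        μ ⁅(X : LieAlg n G), (Y : LieAlg n G)⁆ = Kil n G (A (J X)) Y

end LieGroup

end HomogeneousDirac

end

noncomputable section

namespace HomogeneousDirac

/-! ### Adjoints and equivariance of the Clifford action. -/

section Fock

variable {V : Type*} [NormedAddCommGroup V] [InnerProductSpace ℂ V] [FiniteDimensional ℂ V]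

/-! Viewed on `G`, the canonical connection differentiates along left-invariant fields, whose flows
are right translations. Haar measure on a compact group is right-invariant, so these derivatives
integrate to zero (`integral_derivAlong_eq_zero`). For fixed X in 𝔪 the operator κ(X) is constant on
`G` and skew-adjoint (`inner_clifford_left`). Integrating the derivative of ⟨ψ, κ(X) φ⟩ along X
therefore gives ∫⟨κ(X) ∇_X ψ, φ⟩ = ∫⟨ψ, κ(X) ∇_X φ⟩: the sign from integration by parts cancels the
sign from skewness, and no zeroth-order term, hence no torsion term, can appear. The Dirac operator
is a sum of such terms over a fixed basis. A single term need not be equivariant, which does no harm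
because the integrals are over `G`.

For equivariance, differentiating f(xsy) = T f(x · sys⁻¹) puts Ad_s on the direction
(`derivAlong_mul`). For vector fields this cancels the Ad_s⁻¹ in V(xs). For the Dirac operator it
replaces one frame of 𝔪 by another, which `cliffordContraction_eq` permits, and `fockMap_clifford`
does the rest. Metric compatibility is the product rule, and J commutes with differentiation because
it is a constant linear map.

For coadjoint orbits, averaging an inner product over `G` makes every ad X skew, so tr (ad X)² < 0
for X ≠ 0 and `Kil` is positive definite (`Kil_pos`). Since the derivative of Ad is the bracket
(`vecDeriv_adVec`), 𝔨 consists of the X with μ([X, ·]) = 0. Hence μ([X, Y]) is nondegenerate on 𝔪, Γ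
is skew and invertible, and J = (-Γ²)^(-1/2) Γ is an orthogonal complex structure that inherits from
Γ its commutation with Ad(K) (`exists_polar_of_skew`). -/

instance fockFiniteDimensional : FiniteDimensional ℂ (Fock V) :=
  Module.Finite.of_basis (fockBasis V)

theorem span_range_wedge :
    Submodule.span ℂ (Set.range fun x : Σ p, Fin p → V => wedge x.2) = ⊤ := by
  have h := ExteriorAlgebra.ιMulti_span ℂ V
  have h' := congrArg (Submodule.map (toFock V).toLinearMap) h
  rw [Submodule.map_span, ← Set.range_comp, Submodule.map_top, LinearEquiv.range] at h'
  exact h'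

theorem linearMap_ext_wedge {F : Type*} [AddCommGroup F] [Module ℂ F] {f g : Fock V →ₗ[ℂ] F}
    (h : ∀ (p : ℕ) (X : Fin p → V), f (wedge X) = g (wedge X)) : f = g :=
  LinearMap.ext_on_range span_range_wedge fun x => h x.1 x.2

theorem creation_wedge (X : V) {p : ℕ} (Y : Fin p → V) :
    creation X (wedge Y) = wedge (Fin.cons X Y : Fin (p + 1) → V) := by
  simp only [wedge, ExteriorAlgebra.ιMulti_succ_apply]
  rfl

theorem annihilation_wedge_zero (X : V) (Y : Fin 0 → V) : annihilation X (wedge Y) = 0 := by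
  have h1 : wedge Y = toFock V 1 := congrArg (toFock V) (ExteriorAlgebra.ιMulti_zero_apply Y)
  rw [h1]
  exact (congrArg (toFock V) (CliffordAlgebra.contractLeft_one (Q := (0 : QuadraticForm ℂ V))
    (d := innerₛₗ ℂ X))).trans (map_zero (toFock V))

/-- Contraction is an antiderivation. This is the recursion behind `annihilation_wedge`. -/
theorem annihilation_creation (X Y : V) (φ : Fock V) :
    annihilation X (creation Y φ) = inner ℂ X Y • φ - creation Y (annihilation X φ) :=
  congrArg (toFock V) (CliffordAlgebra.contractLeft_ι_mul (Q := (0 : QuadraticForm ℂ V))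
    (innerₛₗ ℂ X) Y ((toFock V).symm φ))

theorem annihilation_wedge (X : V) {p : ℕ} (Y : Fin (p + 1) → V) :
    annihilation X (wedge Y) =
      ∑ j : Fin (p + 1), ((-1 : ℂ) ^ (j : ℕ) * inner ℂ X (Y j)) • wedge (Y ∘ j.succAbove) := by
  induction p with
  | zero =>
    obtain ⟨a, Z, rfl⟩ : ∃ a Z, Y = Fin.cons a Z := ⟨Y 0, Fin.tail Y, (Fin.cons_self_tail Y).symm⟩
    rw [← creation_wedge, annihilation_creation, annihilation_wedge_zero]
    simp only [map_zero, sub_zero, Fin.sum_univ_succ, Finset.univ_eq_empty, Finset.sum_empty,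
      add_zero, Fin.cons_zero, Fin.val_zero, pow_zero, one_mul]
    congr 2
  | succ p ih =>
    obtain ⟨a, Z, rfl⟩ : ∃ a Z, Y = Fin.cons a Z := ⟨Y 0, Fin.tail Y, (Fin.cons_self_tail Y).symm⟩
    rw [← creation_wedge, annihilation_creation, ih, map_sum, sub_eq_add_neg,
      ← Finset.sum_neg_distrib, Fin.sum_univ_succ (n := p + 1)]
    congr 1
    · simp only [Fin.cons_zero, Fin.val_zero, pow_zero, one_mul]
      congr 2
    · refine Finset.sum_congr rfl fun j _ => ?_
      have h : (Fin.cons a Z : Fin (p + 2) → V) ∘ j.succ.succAbove =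
          Fin.cons a (Z ∘ j.succAbove) := by
        funext i
        refine Fin.cases ?_ (fun i => ?_) i
        · simp
        · simp
      rw [map_smul, creation_wedge, h, Fin.cons_succ, Fin.val_succ, pow_succ, ← neg_smul]
      congr 1
      ring

/-- The annihilation operator is the adjoint of the creation operator. -/
theorem inner_creation_left (X : V) (φ ψ : Fock V) :
    inner ℂ (creation X φ) ψ = inner ℂ φ (annihilation X ψ) := by
  have key : ∀ (p : ℕ) (Z : Fin p → V) (q : ℕ) (Y : Fin q → V),
      inner ℂ (creation X (wedge Z)) (wedge Y) = inner ℂ (wedge Z) (annihilation X (wedge Y)) := by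
    intro p Z q Y
    rw [creation_wedge]
    cases q with
    | zero => rw [annihilation_wedge_zero, inner_zero_right, fock_inner_wedge_of_ne (by omega)]
    | succ q =>
      rw [annihilation_wedge, inner_sum]
      simp only [inner_smul_right]
      by_cases hpq : p = q
      · subst hpq
        -- Laplace expansion of the Gram determinant along the row of X reproduces the annihilation
        -- formula term by term.
        rw [fock_inner_wedge, Matrix.det_succ_row_zero]
        refine Finset.sum_congr rfl fun j _ => ?_
        rw [fock_inner_wedge]
        rfl
      · rw [fock_inner_wedge_of_ne (by omega)]
        simp [fock_inner_wedge_of_ne hpq]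
  have h1 : ∀ (p : ℕ) (Z : Fin p → V) (ψ : Fock V),
      inner ℂ (creation X (wedge Z)) ψ = inner ℂ (wedge Z) (annihilation X ψ) := by
    intro p Z ψ
    exact LinearMap.congr_fun (linearMap_ext_wedge (f := innerₛₗ ℂ (creation X (wedge Z)))
      (g := (innerₛₗ ℂ (wedge Z)).comp (annihilation X)) (key p Z)) ψ
  -- The inner product is conjugate linear in φ, so the extension from wedges to all φ is done after
  -- swapping the two arguments.
  have h2 := LinearMap.congr_fun (linearMap_ext_wedge
    (f := (innerₛₗ ℂ ψ).comp (creation X)) (g := innerₛₗ ℂ (annihilation X ψ)) (fun p Z => by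
      simp only [LinearMap.comp_apply, innerₛₗ_apply_apply]
      rw [← inner_conj_symm, h1, inner_conj_symm])) φ
  simp only [LinearMap.comp_apply, innerₛₗ_apply_apply] at h2
  rw [← inner_conj_symm, h2, inner_conj_symm]

theorem inner_annihilation_left (X : V) (φ ψ : Fock V) :
    inner ℂ (annihilation X φ) ψ = inner ℂ φ (creation X ψ) := by
  rw [← inner_conj_symm, ← inner_creation_left, inner_conj_symm]

/-- The Clifford action of a vector is skew-adjoint. -/
theorem inner_clifford_left (X : V) (φ ψ : Fock V) :
    inner ℂ (clifford X φ) ψ = -inner ℂ φ (clifford X ψ) := by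
  simp only [clifford, LinearMap.smul_apply, LinearMap.add_apply, inner_smul_left,
    inner_smul_right, inner_add_left, inner_add_right, inner_creation_left,
    inner_annihilation_left, Complex.conj_I]
  ring

theorem fockMap_wedge (R : V →ₗ[ℂ] V) {p : ℕ} (Y : Fin p → V) :
    fockMap R (wedge Y) = wedge (R ∘ Y) :=
  congrArg (toFock V) (ExteriorAlgebra.map_apply_ιMulti R Y)

/-- Unitary operators intertwine the Clifford action. -/
theorem fockMap_clifford {R : V →ₗ[ℂ] V} (hR : ∀ X Y, inner ℂ (R X) (R Y) = inner ℂ X Y)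
    (X : V) (φ : Fock V) : fockMap R (clifford X φ) = clifford (R X) (fockMap R φ) := by
  refine LinearMap.congr_fun (linearMap_ext_wedge (f := fockMap R ∘ₗ clifford X)
    (g := clifford (R X) ∘ₗ fockMap R) fun p Y => ?_) φ
  simp only [LinearMap.comp_apply, clifford, LinearMap.smul_apply, LinearMap.add_apply, map_smul,
    map_add, fockMap_wedge, creation_wedge]
  congr 2
  · cases p with
    | zero => simp only [annihilation_wedge_zero, map_zero]
    | succ p =>
      simp only [annihilation_wedge, map_sum, map_smul, fockMap_wedge, Function.comp_apply, hR]
      rfl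
  · congr 1
    funext i
    refine Fin.cases ?_ (fun i => ?_) i <;> simp

end Fock

/-! ### Skew operators: trace of the square and polar decomposition. -/

section LinearAlgebra

variable {V : Type*} [AddCommGroup V] [Module ℝ V] [FiniteDimensional ℝ V]

/-- The inner-product structure of a positive definite symmetric bilinear form. -/
@[reducible]
def coreOfPosDef (B : LinearMap.BilinForm ℝ V) (hs : ∀ x y, B x y = B y x)
    (hp : ∀ x, x ≠ 0 → 0 < B x x) : InnerProductSpace.Core ℝ V where
  inner x y := B x y
  conj_inner_symm x y := hs y x
  add_left := by simp
  smul_left := by simp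
  re_inner_nonneg x := by
    by_cases hx : x = 0
    · simp [hx]
    · exact (hp x hx).le
  definite x hx := by
    by_contra hne
    exact (hp x hne).ne' hx

/-- In a `B`-orthonormal basis the trace is -∑ ‖T bᵢ‖². With T = ad X this gives the sign of the
Killing form. -/
theorem trace_comp_self_neg_of_skew (B : LinearMap.BilinForm ℝ V) (hs : ∀ x y, B x y = B y x)
    (hp : ∀ x, x ≠ 0 → 0 < B x x) (T : V →ₗ[ℝ] V) (hT : ∀ x y, B (T x) y = -B x (T y))
    (hT0 : T ≠ 0) : LinearMap.trace ℝ V (T ∘ₗ T) < 0 := by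
  let _ : NormedAddCommGroup V := (coreOfPosDef B hs hp).toNormedAddCommGroup
  let _ : InnerProductSpace ℝ V := InnerProductSpace.ofCore (coreOfPosDef B hs hp).toCore
  let b := stdOrthonormalBasis ℝ V
  rw [LinearMap.trace_eq_sum_inner _ b]
  have h : ∀ i, inner ℝ (b i) ((T ∘ₗ T) (b i)) = -‖T (b i)‖ ^ 2 := by
    intro i
    rw [← real_inner_self_eq_norm_sq]
    change B (b i) (T (T (b i))) = -B (T (b i)) (T (b i))
    rw [hT, neg_neg]
  simp only [h, Finset.sum_neg_distrib, neg_lt_zero]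
  refine (Finset.sum_nonneg fun i _ => sq_nonneg _).lt_of_ne fun h0 => hT0 ?_
  have h0' := (Finset.sum_eq_zero_iff_of_nonneg fun i _ => sq_nonneg _).1 h0.symm
  refine b.toBasis.ext fun i => ?_
  simpa using h0' i (Finset.mem_univ i)

/-- The polar decomposition `Γ = A J` of an invertible skew-symmetric operator: `J` is an orthogonal
complex structure, and commutes with all that commutes with `Γ`. -/
theorem exists_polar_of_skew (B : LinearMap.BilinForm ℝ V) (hs : ∀ x y, B x y = B y x)
    (hp : ∀ x, x ≠ 0 → 0 < B x x) (Γ : V →ₗ[ℝ] V) (hΓ : ∀ x y, B (Γ x) y = -B x (Γ y))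
    (hinj : Function.Injective Γ) :
    ∃ A J : V →ₗ[ℝ] V, (∀ x y, B (A x) y = B x (A y)) ∧ (∀ x, x ≠ 0 → 0 < B (A x) x) ∧
      (∀ x, A (J x) = Γ x) ∧ (∀ x, J (J x) = -x) ∧ (∀ x y, B (J x) (J y) = B x y) ∧
      ∀ R : V →ₗ[ℝ] V, (∀ x, Γ (R x) = R (Γ x)) → ∀ x, J (R x) = R (J x) := by
  let _ : NormedAddCommGroup V := (coreOfPosDef B hs hp).toNormedAddCommGroup
  let _ : InnerProductSpace ℝ V := InnerProductSpace.ofCore (coreOfPosDef B hs hp).toCore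
  let S : V →ₗ[ℝ] V := -(Γ ∘ₗ Γ)
  have hS : ∀ x, S x = -Γ (Γ x) := fun x => rfl
  have hSsymm : S.IsSymmetric := by
    intro x y
    change B (S x) y = B x (S y)
    simp only [hS, map_neg, LinearMap.neg_apply, hΓ, neg_neg]
  have hΓ0 : ∀ x, x ≠ 0 → Γ x ≠ 0 := fun x hx h => hx (hinj (h.trans (map_zero Γ).symm))
  let b := hSsymm.eigenvectorBasis rfl
  let ev := hSsymm.eigenvalues rfl
  have hb : ∀ i, S (b i) = ev i • b i := fun i => hSsymm.apply_eigenvectorBasis rfl i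
  have hev : ∀ i, 0 < ev i := by
    intro i
    have h1 : B (S (b i)) (b i) = ev i * B (b i) (b i) := by rw [hb]; simp
    have hbi : b i ≠ 0 := b.orthonormal.ne_zero i
    rw [hS, map_neg, LinearMap.neg_apply, hΓ, neg_neg] at h1
    have h2 := hp _ (hΓ0 _ hbi)
    rw [h1] at h2
    exact pos_of_mul_pos_left h2 (hp _ hbi).le
  -- Functions of S are realized as polynomials in S that interpolate them on the spectrum. Being
  -- symmetric and commuting with everything that commutes with Γ then comes for free.
  let node : Finset ℝ := Finset.univ.image ev
  have hnode : ∀ i, ev i ∈ node := fun i => Finset.mem_image_of_mem _ (Finset.mem_univ i)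
  let interp : (ℝ → ℝ) → Polynomial ℝ := fun r => Lagrange.interpolate node id r
  have hinterp : ∀ (r : ℝ → ℝ) i, Polynomial.aeval S (interp r) (b i) = r (ev i) • b i := by
    intro r i
    have hvec : Module.End.HasEigenvector S (ev i) (b i) :=
      hSsymm.hasEigenvector_eigenvectorBasis rfl i
    rw [Module.End.aeval_apply_of_hasEigenvector hvec]
    congr 1
    exact Lagrange.eval_interpolate_at_node r (Function.injective_id.injOn) (hnode i)
  have hsymm : ∀ p : Polynomial ℝ, ∀ x y,
      B (Polynomial.aeval S p x) y = B x (Polynomial.aeval S p y) := by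
    intro p
    induction p using Polynomial.induction_on' with
    | add p q hp hq => intro x y; simp [hp, hq]
    | monomial k c =>
      intro x y
      have : ∀ k : ℕ, ∀ x y, B ((S ^ k) x) y = B x ((S ^ k) y) := fun k => hSsymm.pow k
      simp [Polynomial.aeval_monomial, this]
  have hcomm : ∀ R : V →ₗ[ℝ] V, (∀ x, Γ (R x) = R (Γ x)) → ∀ (p : Polynomial ℝ) x,
      Polynomial.aeval S p (R x) = R (Polynomial.aeval S p x) := by
    intro R hR p x
    have h1 : Commute S R := LinearMap.ext fun x => by
      simp [Module.End.mul_apply, hS, hR]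
    have h2 : Commute (Polynomial.aeval S p) R :=
      (Algebra.commute_of_mem_adjoin_singleton_of_commute
        (Polynomial.aeval_mem_adjoin_singleton ℝ S) h1.symm).symm
    exact LinearMap.congr_fun h2 x
  -- With S = -Γ², A is S^(1/2) = |Γ| and C is S^(-1/2). The complex structure will be C Γ.
  let A := Polynomial.aeval S (interp Real.sqrt)
  let C := Polynomial.aeval S (interp fun t => (Real.sqrt t)⁻¹)
  have hACx : ∀ x, A (C x) = x := by
    intro x
    refine LinearMap.congr_fun (f := A ∘ₗ C) (g := LinearMap.id) (b.toBasis.ext fun i => ?_) x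
    have := (Real.sqrt_pos.2 (hev i)).ne'
    simp [A, C, hinterp, smul_smul, this]
  have hCCx : ∀ x, C (C (S x)) = x := by
    intro x
    refine LinearMap.congr_fun (f := C ∘ₗ C ∘ₗ S) (g := LinearMap.id)
      (b.toBasis.ext fun i => ?_) x
    have h3 : ev i * ((Real.sqrt (ev i))⁻¹ * (Real.sqrt (ev i))⁻¹) = 1 := by
      rw [← mul_inv, Real.mul_self_sqrt (hev i).le, mul_inv_cancel₀ (hev i).ne']
    simp [C, hinterp, smul_smul, hb, h3, mul_assoc]
  have hCΓ : ∀ x, C (Γ x) = Γ (C x) := hcomm Γ (fun x => rfl) _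
  have hJJ : ∀ x, (C ∘ₗ Γ) ((C ∘ₗ Γ) x) = -x := by
    intro x
    simp only [LinearMap.comp_apply]
    rw [← hCΓ, ← neg_neg (Γ (Γ x)), ← hS, map_neg, map_neg, hCCx]
  have hJskew : ∀ x y, B ((C ∘ₗ Γ) x) y = -B x ((C ∘ₗ Γ) y) := by
    intro x y
    simp only [LinearMap.comp_apply]
    rw [hsymm, hΓ, hCΓ]
  refine ⟨A, C ∘ₗ Γ, hsymm _, ?_, fun x => hACx _, hJJ, ?_, ?_⟩
  · intro x hx
    -- A fourth root of S: A = Q² with Q symmetric, so B(Ax, x) = B(Qx, Qx). It is nonzero because A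
    -- is injective with inverse C.
    let Q := Polynomial.aeval S (interp fun t => Real.sqrt (Real.sqrt t))
    have hQ : ∀ x, Q (Q x) = A x := by
      intro x
      refine LinearMap.congr_fun (f := Q ∘ₗ Q) (g := A) (b.toBasis.ext fun i => ?_) x
      simp [A, Q, hinterp, smul_smul]
    rw [← hQ, hsymm]
    refine hp _ fun h0 => hx ?_
    have hA0 : A x = 0 := by rw [← hQ, h0, map_zero]
    have hCA : C (A x) = A (C x) := by
      have h4 : Commute C A := 
        (Commute.all (interp fun t => (Real.sqrt t)⁻¹) (interp Real.sqrt)).map (Polynomial.aeval S)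
      exact LinearMap.congr_fun h4 x
    rw [← hACx x, ← hCA, hA0, map_zero]
  · intro x y
    rw [hJskew, hJJ, map_neg, neg_neg]
  · intro R hR x
    simp only [LinearMap.comp_apply]
    rw [hR, hcomm R hR]

end LinearAlgebra

/-! ### Derivatives of functions on the group, in the chart at the identity. -/

section Calculus

variable {n : ℕ} {G : Type*} [TopologicalSpace G] [ChartedSpace (EuclideanSpace ℝ (Fin n)) G]
  [Group G] [LieGroup (𝓡 n) ∞ G]
  {F : Type*} [NormedAddCommGroup F] [NormedSpace ℝ F]

variable (n G) in
/-- The preferred chart at the identity. -/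
abbrev unitChart : PartialEquiv G (EuclideanSpace ℝ (Fin n)) := extChartAt (𝓡 n) (1 : G)

variable (n G) in
/-- The coordinates of the identity. -/
abbrev unitPoint : EuclideanSpace ℝ (Fin n) := unitChart n G 1

theorem unitPoint_mem : unitPoint n G ∈ (unitChart n G).target := mem_extChartAt_target 1

theorem unitChart_symm_unitPoint : (unitChart n G).symm (unitPoint n G) = 1 :=
  extChartAt_to_inv 1

theorem isOpen_unitChart_target : IsOpen (unitChart n G).target := isOpen_extChartAt_target 1

theorem contMDiffAt_unitChart_symm {u : EuclideanSpace ℝ (Fin n)}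
    (hu : u ∈ (unitChart n G).target) :
    ContMDiffAt 𝓘(ℝ, EuclideanSpace ℝ (Fin n)) (𝓡 n) ∞ (unitChart n G).symm u :=
  (contMDiffOn_extChartAt_symm (I := 𝓡 n) (n := ∞) (1 : G)).contMDiffAt
    (isOpen_unitChart_target.mem_nhds hu)

theorem contMDiffAt_unitChart {x : G} (hx : x ∈ (unitChart n G).source) :
    ContMDiffAt (𝓡 n) 𝓘(ℝ, EuclideanSpace ℝ (Fin n)) ∞ (unitChart n G) x :=
  contMDiffAt_extChartAt' (by rwa [extChartAt_source] at hx)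

/-- The derivative of a vector-valued function on `G`, with the tangent spaces unfolded to the model
space. -/
def vecDeriv (f : G → F) (x : G) : EuclideanSpace ℝ (Fin n) →L[ℝ] F :=
  mfderiv (𝓡 n) 𝓘(ℝ, F) f x

theorem vecDeriv_one_eq {f : G → F} (hf : MDifferentiableAt (𝓡 n) 𝓘(ℝ, F) f 1) :
    vecDeriv f 1 =
      fderiv ℝ (fun v => f ((unitChart n G).symm v)) (unitPoint n G) := by
  have h := hf.hasMFDerivAt.2
  rw [ModelWithCorners.range_eq_univ] at h
  have h' : HasFDerivAt (fun v => f ((unitChart n G).symm v)) (vecDeriv f 1) (unitPoint n G) :=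
    hasFDerivWithinAt_univ.1 h
  exact h'.fderiv.symm

theorem contMDiff_mulLeft (x : G) : ContMDiff (𝓡 n) (𝓡 n) ∞ (fun y : G => x * y) :=
  contMDiff_mul_left

theorem derivAlong_eq {f : G → F} (hf : ContMDiff (𝓡 n) 𝓘(ℝ, F) ∞ f) (x : G)
    (X : EuclideanSpace ℝ (Fin n)) :
    derivAlong f x (X : LieAlg n G) =
      fderiv ℝ (fun v => f (x * (unitChart n G).symm v)) (unitPoint n G) X := by
  have h := vecDeriv_one_eq (n := n) (f := fun y => f (x * y))
    ((hf.comp (contMDiff_mulLeft x)).mdifferentiableAt (by simp))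
  exact congrArg (fun A : EuclideanSpace ℝ (Fin n) →L[ℝ] F => A X) h

/-- The vector variable lives in a model space, where the tangent coordinate changes are trivial.
Smoothness of the manifold derivative in a parameter thus becomes smoothness of a plain `fderiv`. -/
theorem contMDiffAt_fderiv_param {Φ : G → EuclideanSpace ℝ (Fin n) → F} {x₀ : G}
    {e : EuclideanSpace ℝ (Fin n)}
    (h : ContMDiffAt ((𝓡 n).prod 𝓘(ℝ, EuclideanSpace ℝ (Fin n))) 𝓘(ℝ, F) ∞
      (Function.uncurry Φ) (x₀, e)) :
    ContMDiffAt (𝓡 n) 𝓘(ℝ, EuclideanSpace ℝ (Fin n) →L[ℝ] F) ∞ (fun x => fderiv ℝ (Φ x) e) x₀ := by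
  have h1 := ContMDiffAt.mfderiv (m := ∞) (n := ∞) Φ (fun _ : G => e) h contMDiffAt_const le_rfl
  have h2 := inTangentCoordinates_model_space (I := 𝓘(ℝ, EuclideanSpace ℝ (Fin n)))
    (I' := 𝓘(ℝ, F)) (fun _ : G => e) (fun x => Φ x e) (fun x => fderiv ℝ (Φ x) e) x₀
  rw [← h2]
  simpa only [mfderiv_eq_fderiv] using h1

theorem contMDiffAt_mul_unitChart_symm (x : G) {u : EuclideanSpace ℝ (Fin n)}
    (hu : u ∈ (unitChart n G).target) :
    ContMDiffAt ((𝓡 n).prod 𝓘(ℝ, EuclideanSpace ℝ (Fin n))) (𝓡 n) ∞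
      (fun p : G × EuclideanSpace ℝ (Fin n) => p.1 * (unitChart n G).symm p.2) (x, u) :=
  contMDiffAt_fst.mul ((contMDiffAt_unitChart_symm hu).comp (x, u) contMDiffAt_snd)

theorem contMDiff_derivAlong {f : G → F} (hf : ContMDiff (𝓡 n) 𝓘(ℝ, F) ∞ f)
    {X : G → EuclideanSpace ℝ (Fin n)}
    (hX : ContMDiff (𝓡 n) 𝓘(ℝ, EuclideanSpace ℝ (Fin n)) ∞ X) :
    ContMDiff (𝓡 n) 𝓘(ℝ, F) ∞ (fun x => derivAlong f x (X x : LieAlg n G)) := by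
  simp only [derivAlong_eq hf]
  intro x
  refine ContMDiffAt.clm_apply (contMDiffAt_fderiv_param
    (Φ := fun x v => f (x * (unitChart n G).symm v)) ?_) (hX x)
  exact (hf _).comp _ (contMDiffAt_mul_unitChart_symm x unitPoint_mem)

theorem derivAlong_clm {F' : Type*} [NormedAddCommGroup F'] [NormedSpace ℝ F'] (L : F →L[ℝ] F')
    {f : G → F} (hf : ContMDiff (𝓡 n) 𝓘(ℝ, F) ∞ f) (x : G) (X : LieAlg n G) :
    derivAlong (fun y => L (f y)) x X = L (derivAlong f x X) := by
  have hd : MDifferentiableAt (𝓡 n) 𝓘(ℝ, F) (fun y => f (x * y)) 1 :=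
    (hf.comp (contMDiff_mulLeft x)).mdifferentiableAt (by simp)
  have h := mfderiv_comp (I := 𝓡 n) (I' := 𝓘(ℝ, F)) (I'' := 𝓘(ℝ, F')) (1 : G) (g := L)
    (f := fun y => f (x * y)) L.differentiableAt.mdifferentiableAt hd
  rw [mfderiv_eq_fderiv, ContinuousLinearMap.fderiv] at h
  exact congrArg (fun A : EuclideanSpace ℝ (Fin n) →L[ℝ] F' => A X) h

/-- The derivative of an equivariant function is equivariant. -/
theorem derivAlong_mul {f : G → F} (hf : ContMDiff (𝓡 n) 𝓘(ℝ, F) ∞ f) {s : G} (T : F →L[ℝ] F)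
    (hs : ∀ x, f (x * s) = T (f x)) (x : G) (X : LieAlg n G) :
    derivAlong f (x * s) X = T (derivAlong f x (Ad n s X)) := by
  rw [← derivAlong_clm T hf]
  -- Since xsy = x(sys⁻¹)s, the conjugation contributes Ad_s at the identity and the trailing s
  -- contributes T.
  have e : (fun y => f (x * s * y)) = (fun y => T (f (x * y))) ∘ fun y => s * y * s⁻¹ := by
    funext y
    simp only [Function.comp_apply]
    rw [← hs]
    congr 1
    group
  have hd : ∀ z, MDifferentiableAt (𝓡 n) 𝓘(ℝ, F) (fun y => T (f (x * y))) z := fun z =>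
    (T.contMDiff.comp (hf.comp (contMDiff_mulLeft x))).mdifferentiableAt (n := ∞) (by simp)
  have h := mfderiv_comp (I := 𝓡 n) (I' := 𝓡 n) (I'' := 𝓘(ℝ, F)) (1 : G)
    (g := fun y => T (f (x * y))) (f := fun y => s * y * s⁻¹) (hd _) (mdifferentiableAt_conj s 1)
  rw [← e] at h
  have h1 : s * 1 * s⁻¹ = 1 := by simp
  have h' : vecDeriv (n := n) (fun y => f (x * s * y)) 1 =
      (vecDeriv (fun y => T (f (x * y))) (s * 1 * s⁻¹)).comp (rawDeriv (n := n) (fun y => s * y * s⁻¹) 1) := h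
  rw [h1] at h'
  exact congrArg (fun A : EuclideanSpace ℝ (Fin n) →L[ℝ] F => A X) h'

end Calculus

/-! ### Existence of smooth one-parameter subgroups. -/

section OneParameter

variable {n : ℕ} {G : Type*} [TopologicalSpace G] [ChartedSpace (EuclideanSpace ℝ (Fin n)) G]
  [Group G] [LieGroup (𝓡 n) ∞ G]

/-- A left-invariant vector field, with the tangent spaces unfolded to the model space. -/
def leftField (X : EuclideanSpace ℝ (Fin n)) (g : G) : EuclideanSpace ℝ (Fin n) :=
  mulInvariantVectorField (I := 𝓡 n) (G := G) X g

theorem leftField_eq (X : EuclideanSpace ℝ (Fin n)) (g : G) :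
    leftField X g = rawDeriv (n := n) (fun y : G => g * y) 1 X := rfl

theorem rawDeriv_mulLeft_leftField (X : EuclideanSpace ℝ (Fin n)) (x g : G) :
    rawDeriv (n := n) (fun y : G => x * y) g (leftField X g) = leftField X (x * g) := by
  have h := rawDeriv_comp (n := n) (f := fun y : G => x * y) (g := fun y : G => g * y) (x := 1)
    (mdifferentiableAt_mulLeft _ _) (mdifferentiableAt_mulLeft _ _)
  simp only [← mul_assoc, mul_one] at h
  rw [leftField_eq, leftField_eq, h]
  rfl

/-- A left-invariant vector field in the chart at the identity. -/
def chartField (X u : EuclideanSpace ℝ (Fin n)) : EuclideanSpace ℝ (Fin n) :=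
  fderiv ℝ (fun v => unitChart n G ((unitChart n G).symm u * (unitChart n G).symm v))
    (unitPoint n G) X

/-- `chartField` is visibly smooth in ordinary coordinates. This identity transfers that to
left-invariant fields. -/
theorem vecDeriv_unitChart_leftField (X : EuclideanSpace ℝ (Fin n)) {g : G}
    (hg : g ∈ (unitChart n G).source) :
    vecDeriv (unitChart n G) g (leftField X g) =
    chartField (G := G) X (unitChart n G g) := by
  have hg' : g * 1 ∈ (unitChart n G).source := by rwa [mul_one]
  have hd := (contMDiffAt_unitChart hg').mdifferentiableAt (by simp)
  have h := mfderiv_comp (I := 𝓡 n) (I' := 𝓡 n) (I'' := 𝓘(ℝ, EuclideanSpace ℝ (Fin n))) (1 : G)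
    (g := unitChart n G) (f := fun y => g * y) hd (mdifferentiableAt_mulLeft g 1)
  have h2 := vecDeriv_one_eq (n := n) (f := unitChart n G ∘ fun y => g * y)
    (hd.comp (1 : G) (mdifferentiableAt_mulLeft g 1))
  have h3 : (vecDeriv (unitChart n G) (g * 1)).comp
        (rawDeriv (n := n) (fun y => g * y) 1) = _ := h.symm.trans h2
  rw [mul_one] at h3
  rw [chartField, (unitChart n G).left_inv hg]
  exact congrArg (fun A : EuclideanSpace ℝ (Fin n) →L[ℝ] EuclideanSpace ℝ (Fin n) => A X) h3

theorem contDiffAt_chartMul {u v : EuclideanSpace ℝ (Fin n)}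
    (hu : u ∈ (unitChart n G).target) (hv : v ∈ (unitChart n G).target)
    (huv : (unitChart n G).symm u * (unitChart n G).symm v ∈ (unitChart n G).source) :
    ContDiffAt ℝ ∞ (fun p : EuclideanSpace ℝ (Fin n) × EuclideanSpace ℝ (Fin n) =>
      unitChart n G ((unitChart n G).symm p.1 * (unitChart n G).symm p.2)) (u, v) := by
  rw [← contMDiffAt_iff_contDiffAt]
  refine (contMDiffAt_unitChart huv).comp (u, v) (ContMDiffAt.mul ?_ ?_)
  · exact (contMDiffAt_unitChart_symm hu).comp (u, v)
      (contMDiffAt_iff_contDiffAt.2 contDiffAt_fst)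
  · exact (contMDiffAt_unitChart_symm hv).comp (u, v)
      (contMDiffAt_iff_contDiffAt.2 contDiffAt_snd)

theorem chartMul_mem_source {u : EuclideanSpace ℝ (Fin n)} (hu : u ∈ (unitChart n G).target) :
    (unitChart n G).symm u * (unitChart n G).symm (unitPoint n G) ∈ (unitChart n G).source := by
  rw [unitChart_symm_unitPoint, mul_one]
  exact (unitChart n G).map_target hu

theorem contDiffOn_chartField (X : EuclideanSpace ℝ (Fin n)) :
    ContDiffOn ℝ ∞ (chartField (G := G) X) (unitChart n G).target := by
  intro u hu
  have h := contDiffAt_chartMul hu unitPoint_mem (chartMul_mem_source hu)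
  have h2 : ContDiffAt ℝ ∞ (fun u => fderiv ℝ (fun v => unitChart n G
      ((unitChart n G).symm u * (unitChart n G).symm v)) (unitPoint n G)) u :=
    ContDiffAt.fderiv (n := ∞) (m := ∞) (f := fun u v => unitChart n G
      ((unitChart n G).symm u * (unitChart n G).symm v)) (g := fun _ => unitPoint n G) h
      contDiffAt_const le_rfl
  exact (h2.clm_apply contDiffAt_const).contDiffWithinAt

theorem contMDiff_leftField (X : EuclideanSpace ℝ (Fin n)) :
    ContMDiff (𝓡 n) (𝓡 n).tangent 1 (fun g : G =>
      (⟨g, mulInvariantVectorField (I := 𝓡 n) X g⟩ : TangentBundle (𝓡 n) G)) :=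
  (contMDiff_mulInvariantVectorField (I := 𝓡 n) (G := G) X).of_le (by
    rw [minSmoothness_of_isRCLikeNormedField]; norm_num)

theorem isMIntegralCurveOn_mulLeft {X : EuclideanSpace ℝ (Fin n)} {γ : ℝ → G} {s : Set ℝ}
    (h : IsMIntegralCurveOn (I := 𝓡 n) γ (mulInvariantVectorField (I := 𝓡 n) (G := G) X) s)
    (x : G) :
    IsMIntegralCurveOn (I := 𝓡 n) (fun t => x * γ t)
      (mulInvariantVectorField (I := 𝓡 n) (G := G) X) s := by
  intro t ht
  have h1 := (mdifferentiableAt_mulLeft (n := n) x (γ t)).hasMFDerivAt.comp_hasMFDerivWithinAt t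
    (h t ht)
  have h2 : (rawDeriv (n := n) (fun y : G => x * y) (γ t)).comp
      ((1 : ℝ →L[ℝ] ℝ).smulRight (leftField X (γ t))) =
      (1 : ℝ →L[ℝ] ℝ).smulRight (leftField X (x * γ t)) := by
    ext1
    simp [rawDeriv_mulLeft_leftField]
  exact h1.congr_mfderiv h2

/-- Bootstrap from c' = W ∘ c: if c is of class C^k, so is c', and c is of class C^(k+1). -/
theorem contDiffOn_of_integralCurve {E : Type*} [NormedAddCommGroup E] [NormedSpace ℝ E]
    {W : E → E} {U : Set E} (hW : ContDiffOn ℝ ∞ W U) {c : ℝ → E} {s : Set ℝ} (hs : IsOpen s)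
    (hc : ∀ t ∈ s, HasDerivAt c (W (c t)) t) (hU : ∀ t ∈ s, c t ∈ U) : ContDiffOn ℝ ∞ c s := by
  rw [contDiffOn_infty]
  intro k
  have hd : DifferentiableOn ℝ c s := fun t ht =>
    (hc t ht).differentiableAt.differentiableWithinAt
  induction k with
  | zero => exact contDiffOn_zero.2 hd.continuousOn
  | succ k ih =>
    rw [Nat.cast_succ, contDiffOn_succ_iff_deriv_of_isOpen hs]
    refine ⟨hd, fun h => absurd h (by simp), ?_⟩
    refine ((hW.of_le (by exact_mod_cast le_top)).comp ih hU).congr fun t ht => (hc t ht).deriv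

/-- Every `X ∈ 𝔤` is the velocity of a one-parameter subgroup. -/
theorem exists_oneParameter [T2Space G] (X : EuclideanSpace ℝ (Fin n)) :
    ∃ γ : ℝ → G, ContMDiff 𝓘(ℝ, ℝ) (𝓡 n) ∞ γ ∧ (∀ s t, γ (s + t) = γ s * γ t) ∧
      (mfderiv 𝓘(ℝ, ℝ) (𝓡 n) γ 0 (1 : ℝ) : EuclideanSpace ℝ (Fin n)) = X := by
  set V := mulInvariantVectorField (I := 𝓡 n) (G := G) X with hV
  have hvs := contMDiff_leftField (G := G) X
  obtain ⟨γ₀, h0, hγ₀⟩ := exists_isMIntegralCurveAt_of_contMDiffAt_boundaryless (I := 𝓡 n) 0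
    (hvs.contMDiffAt (x := 1))
  obtain ⟨ε, hε, hγ₀⟩ := isMIntegralCurveAt_iff'.1 hγ₀
  rw [Real.ball_eq_Ioo, zero_sub, zero_add] at hγ₀
  -- Left translates of the local curve through 1 give integral curves through every point with the
  -- same lifetime ε, so the field is complete.
  obtain ⟨γ, hγ1, hγ⟩ := exists_isMIntegralCurve_of_isMIntegralCurveOn (I := 𝓡 n) hvs hε
    (fun x => ⟨fun t => x * γ₀ t, by simp [h0], isMIntegralCurveOn_mulLeft hγ₀ x⟩) 1
  have hmul : ∀ s t, γ (s + t) = γ s * γ t := by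
    intro s t
    have h1 : IsMIntegralCurve (I := 𝓡 n) (fun t => γ s * γ t) V := by
      rw [isMIntegralCurve_iff_isMIntegralCurveOn] at hγ ⊢
      exact isMIntegralCurveOn_mulLeft hγ (γ s)
    -- Both t ↦ γ(s + t) and t ↦ γ(s) γ(t) are integral curves with value γ(s) at 0, so uniqueness
    -- gives the group law.
    have h2 := isMIntegralCurve_Ioo_eq_of_contMDiff_boundaryless (I := 𝓡 n) (t₀ := 0) hvs
      (hγ.comp_add s) h1 (by simp [hγ1])
    have := congrFun h2 t
    simpa [add_comm] using this
  have hcont : Continuous γ := hγ.continuous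
  let s : Set ℝ := γ ⁻¹' (unitChart n G).source
  have hs : IsOpen s := (isOpen_extChartAt_source (I := 𝓡 n) (1 : G)).preimage hcont
  have h0s : (0 : ℝ) ∈ s := by
    change γ 0 ∈ (unitChart n G).source
    rw [hγ1]
    exact mem_extChartAt_source 1
  -- An integral curve is so far only differentiable. Smoothness is proved near 0 in the chart and
  -- then carried to every t by the group law.
  have hc : ContDiffOn ℝ ∞ (fun t => unitChart n G (γ t)) s := by
    refine contDiffOn_of_integralCurve (contDiffOn_chartField (G := G) X) hs (fun t ht => ?_)
      (fun t ht => (unitChart n G).map_source ht)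
    have h1 := ((contMDiffAt_unitChart (n := n) (x := γ t) ht).mdifferentiableAt
      (by simp)).hasMFDerivAt.comp t (hγ t)
    rw [hasMFDerivAt_iff_hasFDerivAt] at h1
    rw [hasDerivAt_iff_hasFDerivAt]
    refine h1.congr_fderiv (ContinuousLinearMap.ext fun r : ℝ => ?_)
    have h2 := vecDeriv_unitChart_leftField X (g := γ t) ht
    have h3 : vecDeriv (unitChart n G) (γ t) (r • leftField X (γ t)) =
      r • chartField (G := G) X (unitChart n G (γ t)) := by rw [map_smul, h2]
    exact h3
  have hsm0 : ContMDiffAt 𝓘(ℝ, ℝ) (𝓡 n) ∞ γ 0 := by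
    have h1 : ContMDiffAt 𝓘(ℝ, ℝ) (𝓡 n) ∞
        (fun t => (unitChart n G).symm (unitChart n G (γ t))) 0 :=
      (contMDiffAt_unitChart_symm ((unitChart n G).map_source h0s)).comp (0 : ℝ)
        (contMDiffAt_iff_contDiffAt.2 (hc.contDiffAt (hs.mem_nhds h0s)))
    refine h1.congr_of_eventuallyEq ?_
    filter_upwards [hs.mem_nhds h0s] with t ht
    exact ((unitChart n G).left_inv ht).symm
  refine ⟨γ, fun t => ?_, hmul, ?_⟩
  · have h1 : γ = fun r => γ t * γ (r - t) := by
      funext r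
      rw [← hmul]
      congr 1
      ring
    rw [h1]
    refine contMDiffAt_const.mul ?_
    have h2 : ContMDiffAt 𝓘(ℝ, ℝ) 𝓘(ℝ, ℝ) ∞ (fun r : ℝ => r - t) t :=
      contMDiffAt_iff_contDiffAt.2 (contDiffAt_id.sub contDiffAt_const)
    refine ContMDiffAt.comp (g := γ) t ?_ h2
    simpa using hsm0
  · have h1 := (hγ 0).mfderiv
    have h2 : (mfderiv 𝓘(ℝ, ℝ) (𝓡 n) γ 0 (1 : ℝ) : EuclideanSpace ℝ (Fin n)) =
        (1 : ℝ) • leftField X (γ 0) :=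
      congrArg (fun A : ℝ →L[ℝ] EuclideanSpace ℝ (Fin n) => A 1) h1
    rw [h2, hγ1, one_smul, leftField_eq]
    simp only [one_mul]
    rw [rawDeriv_id]
    rfl

end OneParameter

/-! ### Invariant integration and the product rule. -/

section Integration

variable {n : ℕ} {G : Type*} [TopologicalSpace G] [ChartedSpace (EuclideanSpace ℝ (Fin n)) G]
  [Group G] [LieGroup (𝓡 n) ∞ G]
  {F : Type*} [NormedAddCommGroup F] [NormedSpace ℝ F]

/-- A Haar measure on a compact group is right-invariant. -/
theorem isMulRightInvariant_of_compactSpace {G : Type*} [TopologicalSpace G] [Group G]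
    [IsTopologicalGroup G] [CompactSpace G] [MeasurableSpace G] [BorelSpace G] (ν : Measure G)
    [ν.IsHaarMeasure] : ν.IsMulRightInvariant := by
  refine ⟨fun g => ?_⟩
  -- The right translate of ν is still left-invariant, hence a multiple of ν. The total mass, finite
  -- and nonzero, forces the factor 1.
  have h := Measure.isMulInvariant_eq_smul_of_compactSpace (ν.map (· * g)) ν
  set c := Measure.haarScalarFactor (ν.map (· * g)) ν with hc
  have h1 := congrArg (fun m : Measure G => m Set.univ) h
  rw [Measure.map_apply (measurable_mul_const g) MeasurableSet.univ, Set.preimage_univ] at h1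
  have h0 : ν Set.univ ≠ 0 := isOpen_univ.measure_ne_zero ν Set.univ_nonempty
  have hf : ν Set.univ ≠ ⊤ := isCompact_univ.measure_lt_top.ne
  have h2 : (c : ENNReal) = 1 := by
    have h3 : (1 : ENNReal) * ν Set.univ = c * ν Set.univ := by
      rw [one_mul]; exact h1
    exact ((ENNReal.mul_left_inj h0 hf).1 h3).symm
  have h4 : c = 1 := by exact_mod_cast h2
  rw [h, h4, one_smul]

theorem hasDerivAt_comp_curve {f : G → F} (hf : MDifferentiableAt (𝓡 n) 𝓘(ℝ, F) f 1) {γ : ℝ → G}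
    (hγ : ContMDiff 𝓘(ℝ, ℝ) (𝓡 n) ∞ γ) (h1 : γ 0 = 1) {X : EuclideanSpace ℝ (Fin n)}
    (hX : (mfderiv 𝓘(ℝ, ℝ) (𝓡 n) γ 0 (1 : ℝ) : EuclideanSpace ℝ (Fin n)) = X) :
    HasDerivAt (fun t => f (γ t)) (vecDeriv f 1 X) 0 := by
  have hγ' := (hγ.mdifferentiableAt (x := 0) (by simp)).hasMFDerivAt
  have h2 : MDifferentiableAt (𝓡 n) 𝓘(ℝ, F) f (γ 0) := by rwa [h1]
  have h3 := h2.hasMFDerivAt.comp (0 : ℝ) hγ'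
  rw [hasMFDerivAt_iff_hasFDerivAt] at h3
  rw [hasDerivAt_iff_hasFDerivAt]
  refine h3.congr_fderiv ?_
  ext1
  have h4 : vecDeriv f (γ 0) (mfderiv 𝓘(ℝ, ℝ) (𝓡 n) γ 0 (1 : ℝ) : EuclideanSpace ℝ (Fin n)) =
    (1 : ℝ) • vecDeriv f 1 X := by rw [hX, h1, one_smul]
  exact h4

/-- Writing γ(r) = γ(t) γ(r - t) reduces the derivative at t to the one at 0, based at x γ(t). -/
theorem hasDerivAt_mul_oneParameter {f : G → F} (hf : ContMDiff (𝓡 n) 𝓘(ℝ, F) ∞ f) {γ : ℝ → G}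
    (hγ : ContMDiff 𝓘(ℝ, ℝ) (𝓡 n) ∞ γ) (hmul : ∀ s t, γ (s + t) = γ s * γ t)
    {X : EuclideanSpace ℝ (Fin n)}
    (hX : (mfderiv 𝓘(ℝ, ℝ) (𝓡 n) γ 0 (1 : ℝ) : EuclideanSpace ℝ (Fin n)) = X) (x : G) (t : ℝ) :
    HasDerivAt (fun t => f (x * γ t)) (derivAlong f (x * γ t) (X : LieAlg n G)) t := by
  have h1 : γ 0 = 1 := by simpa using hmul 0 0
  have h := hasDerivAt_comp_curve (n := n) (f := fun y => f (x * γ t * y))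
    ((hf.comp (contMDiff_mulLeft _)).mdifferentiableAt (by simp)) hγ h1 hX
  have h2 : HasDerivAt (fun r : ℝ => r - t) 1 t := (hasDerivAt_id t).sub_const t
  have h3 := HasDerivAt.scomp (g₁ := fun s => f (x * γ t * γ s)) t (by simpa using h) h2
  rw [one_smul] at h3
  refine h3.congr_of_eventuallyEq (Filter.Eventually.of_forall fun r => ?_)
  simp only [Function.comp_apply, mul_assoc]
  rw [← hmul]
  congr 3
  ring

/-- The integral over `G` of a derivative along a left-invariant vector field vanishes. -/
theorem integral_derivAlong_eq_zero [CompactSpace G] [T2Space G] [MeasurableSpace G]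
    [BorelSpace G] (ν : Measure G) [ν.IsHaarMeasure] [FiniteDimensional ℝ F] {f : G → F}
    (hf : ContMDiff (𝓡 n) 𝓘(ℝ, F) ∞ f) (X : EuclideanSpace ℝ (Fin n)) :
    ∫ x, derivAlong f x (X : LieAlg n G) ∂ν = 0 := by
  have : IsTopologicalGroup G := topologicalGroup_of_lieGroup (𝓡 n) ∞
  have : ν.IsMulRightInvariant := isMulRightInvariant_of_compactSpace ν
  have : ProperSpace F := FiniteDimensional.proper_real F
  obtain ⟨γ, hγ, hmul, hX⟩ := exists_oneParameter (G := G) X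
  have h1 : γ 0 = 1 := by simpa using hmul 0 0
  have hc : Continuous fun x : G => derivAlong f x (X : LieAlg n G) :=
    (contMDiff_derivAlong hf (X := fun _ => X) contMDiff_const).continuous
  obtain ⟨C, hC⟩ := isCompact_univ.exists_bound_of_continuousOn hc.continuousOn
  have hint : ∀ {u : G → F}, Continuous u → Integrable u ν := fun hu =>
    hu.integrable_of_hasCompactSupport (HasCompactSupport.of_compactSpace _)
  -- By right-invariance ∫ f(x γ(t)) does not depend on t. Differentiation under the integral is
  -- dominated by a bound C of the continuous derivative on the compact group.
  have h := hasDerivAt_integral_of_dominated_loc_of_deriv_le (μ := ν) (s := Set.univ)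
    (F := fun (t : ℝ) x => f (x * γ t)) (x₀ := 0)
    (F' := fun t x => derivAlong f (x * γ t) (X : LieAlg n G)) (bound := fun _ => C)
    Filter.univ_mem
    (Filter.Eventually.of_forall fun t =>
      (hint (hf.continuous.comp (continuous_mul_const (γ t)))).aestronglyMeasurable)
    (hint (hf.continuous.comp (continuous_mul_const (γ 0))))
    (hint (hc.comp (continuous_mul_const (γ 0)))).aestronglyMeasurable
    (Filter.Eventually.of_forall fun x t _ => hC _ (Set.mem_univ _))
    (integrable_const C)
    (Filter.Eventually.of_forall fun x t _ => hasDerivAt_mul_oneParameter hf hγ hmul hX x t)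
  have h2 := h.2
  simp only [h1, mul_one, integral_mul_right_eq_self (μ := ν) f] at h2
  exact h2.unique (hasDerivAt_const _ _)

theorem contMDiff_inner {H : Type*} [NormedAddCommGroup H] [InnerProductSpace ℂ H]
    {f g : G → H} (hf : ContMDiff (𝓡 n) 𝓘(ℝ, H) ∞ f) (hg : ContMDiff (𝓡 n) 𝓘(ℝ, H) ∞ g) :
    ContMDiff (𝓡 n) 𝓘(ℝ, ℂ) ∞ (fun y => inner ℂ (f y) (g y)) := by
  have h1 : ContDiff ℝ ∞ (fun p : H × H => inner ℂ p.1 p.2) := contDiff_inner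
  exact h1.contMDiff.comp (hf.prodMk_space hg)

theorem derivAlong_inner {H : Type*} [NormedAddCommGroup H] [InnerProductSpace ℂ H]
    {f g : G → H} (hf : ContMDiff (𝓡 n) 𝓘(ℝ, H) ∞ f) (hg : ContMDiff (𝓡 n) 𝓘(ℝ, H) ∞ g) (x : G)
    (X : LieAlg n G) :
    derivAlong (fun y => inner ℂ (f y) (g y)) x X =
      inner ℂ (f x) (derivAlong g x X) + inner ℂ (derivAlong f x X) (g x) := by
  have hd : ∀ {u : G → H}, ContMDiff (𝓡 n) 𝓘(ℝ, H) ∞ u →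
      DifferentiableAt ℝ (fun v => u (x * (unitChart n G).symm v)) (unitPoint n G) := by
    intro u hu
    have h1 : ContMDiffAt 𝓘(ℝ, EuclideanSpace ℝ (Fin n)) 𝓘(ℝ, H) ∞
        (fun v => u (x * (unitChart n G).symm v)) (unitPoint n G) :=
      (hu _).comp _ (contMDiffAt_const.mul (contMDiffAt_unitChart_symm unitPoint_mem))
    exact (contMDiffAt_iff_contDiffAt.1 h1).differentiableAt (by simp)
  have hi := contMDiff_inner hf hg
  have h := fderiv_inner_apply ℂ (hd hf) (hd hg) X
  simp only [unitChart_symm_unitPoint, mul_one] at h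
  exact (derivAlong_eq hi x X).trans (h.trans (congrArg₂ (· + ·)
    (congrArg _ (derivAlong_eq hg x X).symm)
    (congrArg (fun z => inner ℂ z (g x)) (derivAlong_eq hf x X).symm)))

end Integration

/-! ### The canonical connection and its Dirac operator. -/

namespace AlmostHermitian

variable {n : ℕ} {G : Type*} [TopologicalSpace G] [ChartedSpace (EuclideanSpace ℝ (Fin n)) G]
  [Group G] [LieGroup (𝓡 n) ∞ G] {K : Subgroup G} (h : AlmostHermitian n K)

theorem inner_eq (X Y : h.MJ) :
    inner ℂ X Y = ⟨h.g₀ (h.toM X) (h.toM Y), h.g₀ (h.J (h.toM X)) (h.toM Y)⟩ := rfl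

theorem toM_AdJ (s : K) (X : h.MJ) : h.toM (h.AdJ s X) = AdM s (h.toM X) := rfl

theorem inner_AdJ (s : K) (X Y : h.MJ) : inner ℂ (h.AdJ s X) (h.AdJ s Y) = inner ℂ X Y := by
  simp only [inner_eq, toM_AdJ, h.J_Ad, h.g₀_Ad]

theorem AdJ_AdJ_inv (s : K) (X : h.MJ) : h.AdJ s (h.AdJ s⁻¹ X) = X :=
  h.toM.injective (Subtype.ext (Ad_Ad_inv (s : G) _))

theorem AdJ_inv_AdJ (s : K) (X : h.MJ) : h.AdJ s⁻¹ (h.AdJ s X) = X :=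
  h.toM.injective (Subtype.ext (Ad_inv_Ad (s : G) _))

/-- The inclusion of `𝔪_J` in `𝔤`, with the tangent space unfolded to the model space. -/
def incl : h.MJ →L[ℝ] EuclideanSpace ℝ (Fin n) :=
  LinearMap.toContinuousLinearMap
    ((tangentM n K).subtype ∘ₗ h.toMₗ.toLinearMap : h.MJ →ₗ[ℝ] EuclideanSpace ℝ (Fin n))

theorem incl_AdJ (s : K) (X : h.MJ) : h.incl (h.AdJ s X) = Ad n (s : G) (h.incl X) := rfl

section Connection

variable {F : Type*} [NormedAddCommGroup F] [NormedSpace ℝ F]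

theorem canonicalConnection_eq (V : G → h.MJ) (f : G → F) (x : G) :
    h.canonicalConnection V f x = derivAlong f x (h.incl (V x) : LieAlg n G) := rfl

theorem contMDiff_canonicalConnection {V : G → h.MJ} (hV : ContMDiff (𝓡 n) 𝓘(ℝ, h.MJ) ∞ V)
    {f : G → F} (hf : ContMDiff (𝓡 n) 𝓘(ℝ, F) ∞ f) :
    ContMDiff (𝓡 n) 𝓘(ℝ, F) ∞ (h.canonicalConnection V f) :=
  contMDiff_derivAlong hf (X := fun x => h.incl (V x)) (h.incl.contMDiff.comp hV)

/-- The Ad_s that `derivAlong_mul` puts on the direction cancels the Ad_s⁻¹ in V(xs), leaving only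
the transformation of W. -/
theorem canonicalConnection_mem {V : G → h.MJ} (hV : V ∈ h.vectorFields) {W : G → h.MJ}
    (hW : W ∈ h.vectorFields) : h.canonicalConnection V W ∈ h.vectorFields := by
  refine ⟨h.contMDiff_canonicalConnection hV.1 hW.1, fun x s => ?_⟩
  have h1 := derivAlong_mul hW.1 (s := (s : G))
    (LinearMap.toContinuousLinearMap ((h.AdJ s⁻¹).restrictScalars ℝ)) (fun x => hW.2 x s) x
    (h.incl (V (x * s)))
  rw [canonicalConnection_eq, h1, hV.2 x s, ← incl_AdJ, AdJ_AdJ_inv]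
  rfl

/-- The metric g₀ is the real part of the complex inner product, so this is the real part of
`derivAlong_inner`. -/
theorem compatibleWithMetric_canonicalConnection :
    h.CompatibleWithMetric h.canonicalConnection := by
  intro U hU V hV W hW x
  have hi := contMDiff_inner hV.1 hW.1
  have h1 := derivAlong_clm Complex.reCLM hi x (h.incl (U x))
  have h2 := congrArg Complex.re (derivAlong_inner hV.1 hW.1 x (h.incl (U x)))
  rw [add_comm]
  exact h1.trans h2

theorem commutesWithJ_canonicalConnection : h.CommutesWithJ h.canonicalConnection := by
  intro V hV W hW x
  let L : h.MJ →ₗ[ℝ] h.MJ := h.toMₗ.symm.toLinearMap ∘ₗ h.J ∘ₗ h.toMₗ.toLinearMap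
  exact derivAlong_clm (LinearMap.toContinuousLinearMap L) hW.1 x (h.incl (V x))

end Connection

section Dirac

variable {χ : K →ₜ* Circle}

theorem dirac_eq (ψ : G → h.Spinors) (x : G) : h.dirac ψ x =
    ∑ j, (clifford (stdOrthonormalBasis ℂ h.MJ j)
        (h.canonicalConnection (fun _ => stdOrthonormalBasis ℂ h.MJ j) ψ x) +
      clifford (Complex.I • stdOrthonormalBasis ℂ h.MJ j)
        (h.canonicalConnection (fun _ => Complex.I • stdOrthonormalBasis ℂ h.MJ j) ψ x)) := rfl

/-- The Clifford action of a vector as a continuous real-linear map. -/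
def cliffordL (X : h.MJ) : h.Spinors →L[ℝ] h.Spinors :=
  ((LinearMap.toContinuousLinearMap (clifford X)).restrictScalars ℝ)

theorem contMDiff_clifford_canonicalConnection (X : h.MJ) {ψ : G → h.Spinors}
    (hψ : ContMDiff (𝓡 n) 𝓘(ℝ, h.Spinors) ∞ ψ) :
    ContMDiff (𝓡 n) 𝓘(ℝ, h.Spinors) ∞
      (fun x => clifford X (h.canonicalConnection (fun _ => X) ψ x)) :=
  (h.cliffordL X).contMDiff.comp (h.contMDiff_canonicalConnection contMDiff_const hψ)

theorem contMDiff_dirac {ψ : G → h.Spinors} (hψ : ContMDiff (𝓡 n) 𝓘(ℝ, h.Spinors) ∞ ψ) :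
    ContMDiff (𝓡 n) 𝓘(ℝ, h.Spinors) ∞ (h.dirac ψ) := by
  have : h.dirac ψ = _ := funext (h.dirac_eq ψ)
  rw [this]
  exact contMDiff_finsetSum fun j _ => (h.contMDiff_clifford_canonicalConnection _ hψ).add
    (h.contMDiff_clifford_canonicalConnection _ hψ)

theorem dirac_mem_spinorFields {ψ : G → h.Spinors} (hψ : ψ ∈ h.spinorFields χ) :
    h.dirac ψ ∈ h.spinorFields χ := by
  refine ⟨h.contMDiff_dirac hψ.1, fun x s => ?_⟩
  set b := stdOrthonormalBasis ℂ h.MJ with hb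
  let u : Fin (Module.finrank ℂ h.MJ) ⊕ Fin (Module.finrank ℂ h.MJ) → h.MJ :=
    Sum.elim b (fun j => Complex.I • b j)
  have hu : ∀ v : h.MJ, v = ∑ j, (inner ℂ (u j) v : ℂ).re • u j := by
    intro v
    rw [Fintype.sum_sum_type, ← Finset.sum_add_distrib]
    conv_lhs => rw [← b.sum_repr' v]
    refine Finset.sum_congr rfl fun j _ => ?_
    simp only [u, Sum.elim_inl, Sum.elim_inr, inner_smul_left, ← Complex.coe_smul, smul_smul,
      ← add_smul]
    congr 1
    apply Complex.ext <;> simp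
  have hw : ∀ v : h.MJ, v = ∑ j, (inner ℂ (h.AdJ s (u j)) v : ℂ).re • h.AdJ s (u j) := by
    intro v
    have h1 := congrArg (h.AdJ s) (hu (h.AdJ s⁻¹ v))
    rw [AdJ_AdJ_inv, map_sum] at h1
    conv_lhs => rw [h1]
    refine Finset.sum_congr rfl fun j _ => ?_
    rw [← Complex.coe_smul, map_smul, Complex.coe_smul, ← h.inner_AdJ s (u j), AdJ_AdJ_inv]
  let T : h.Spinors →ₗ[ℂ] h.Spinors := (starRingEnd ℂ) (χ s : ℂ) • fockMap (h.AdJ s⁻¹)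
  have hT : ∀ x, ψ (x * s) = T (ψ x) := fun x => hψ.2 x s
  change _ = T (h.dirac ψ x)
  -- The contraction at xs uses the real frame u = (bⱼ, i bⱼ), and the one at x uses its unitary
  -- image Ad_s u. The two sums then match term by term.
  rw [dirac, dirac, cliffordContraction_eq u hu, cliffordContraction_eq _ hw, map_sum]
  refine Finset.sum_congr rfl fun j _ => ?_
  have h1 : h.differential ψ (x * s) (u j) = T (h.differential ψ x (h.AdJ s (u j))) := by
    exact derivAlong_mul hψ.1 (s := (s : G))
      ((LinearMap.toContinuousLinearMap T).restrictScalars ℝ) hT x (h.incl (u j))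
  rw [h1]
  simp only [T, LinearMap.smul_apply, map_smul]
  rw [fockMap_clifford (h.inner_AdJ s⁻¹), AdJ_inv_AdJ]

theorem integrable_inner [CompactSpace G] [MeasurableSpace G] [BorelSpace G] (ν : Measure G)
    [ν.IsHaarMeasure] {f g : G → h.Spinors} (hf : ContMDiff (𝓡 n) 𝓘(ℝ, h.Spinors) ∞ f)
    (hg : ContMDiff (𝓡 n) 𝓘(ℝ, h.Spinors) ∞ g) : Integrable (fun x => inner ℂ (f x) (g x)) ν :=
  (hf.continuous.inner hg.continuous).integrable_of_hasCompactSupport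
    (HasCompactSupport.of_compactSpace _)

/-- Integration by parts for ⟨ψ, κ(X) φ⟩ with X constant on `G`. No equivariance of ψ or φ is
needed, so each term of the Dirac sum can be treated alone. -/
theorem integral_inner_clifford_canonicalConnection [CompactSpace G] [T2Space G]
    [MeasurableSpace G] [BorelSpace G] (ν : Measure G) [ν.IsHaarMeasure] (X : h.MJ)
    {ψ φ : G → h.Spinors} (hψ : ContMDiff (𝓡 n) 𝓘(ℝ, h.Spinors) ∞ ψ)
    (hφ : ContMDiff (𝓡 n) 𝓘(ℝ, h.Spinors) ∞ φ) :
    ∫ x, inner ℂ (clifford X (h.canonicalConnection (fun _ => X) ψ x)) (φ x) ∂ν =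
      ∫ x, inner ℂ (ψ x) (clifford X (h.canonicalConnection (fun _ => X) φ x)) ∂ν := by
  have hκφ : ContMDiff (𝓡 n) 𝓘(ℝ, h.Spinors) ∞ (fun x => clifford X (φ x)) :=
    (h.cliffordL X).contMDiff.comp hφ
  have hi := contMDiff_inner hψ hκφ
  have h0 := integral_derivAlong_eq_zero ν hi (h.incl X)
  have h2 : ∀ x, derivAlong (fun y => inner ℂ (ψ y) (clifford X (φ y))) x
      (h.incl X : LieAlg n G) =
      inner ℂ (ψ x) (clifford X (h.canonicalConnection (fun _ => X) φ x)) -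
        inner ℂ (clifford X (h.canonicalConnection (fun _ => X) ψ x)) (φ x) := by
    intro x
    rw [inner_clifford_left, sub_neg_eq_add]
    refine (derivAlong_inner hψ hκφ x (h.incl X)).trans (congrArg₂ (· + ·) ?_ rfl)
    exact congrArg _ (derivAlong_clm (h.cliffordL X) hφ x (h.incl X))
  simp only [h2] at h0
  rw [integral_sub (h.integrable_inner ν hψ (h.contMDiff_clifford_canonicalConnection X hφ))
    (h.integrable_inner ν (h.contMDiff_clifford_canonicalConnection X hψ) hφ)] at h0
  exact (sub_eq_zero.1 h0).symm

theorem formallySelfAdjoint_dirac [CompactSpace G] [T2Space G] [MeasurableSpace G] [BorelSpace G]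
    (ν : Measure G) [ν.IsHaarMeasure] : h.FormallySelfAdjoint ν χ h.dirac := by
  intro ψ hψ φ hφ
  have hc := fun X => h.integrable_inner ν (h.contMDiff_clifford_canonicalConnection X hψ.1) hφ.1
  have hc' := fun X => h.integrable_inner ν hψ.1 (h.contMDiff_clifford_canonicalConnection X hφ.1)
  simp only [innerL2, dirac_eq, sum_inner, inner_sum, inner_add_left, inner_add_right]
  refine (integral_finsetSum _ fun j _ => (hc _).add (hc _)).trans
    (Eq.trans ?_ (integral_finsetSum _ fun j _ => (hc' _).add (hc' _)).symm)
  refine Finset.sum_congr rfl fun j _ => ?_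
  refine (integral_add (hc _) (hc _)).trans (Eq.trans ?_ (integral_add (hc' _) (hc' _)).symm)
  rw [integral_inner_clifford_canonicalConnection h ν _ hψ.1 hφ.1,
    integral_inner_clifford_canonicalConnection h ν _ hψ.1 hφ.1]

end Dirac

end AlmostHermitian

/-! ### Mixed second derivatives of a product with unit. -/

section SecondDerivative

variable {E : Type*} [NormedAddCommGroup E] [NormedSpace ℝ E]

theorem fderiv_left_apply {m : E × E → E} {u v : E} (hm : DifferentiableAt ℝ m (u, v)) (X : E) :
    fderiv ℝ m (u, v) (X, 0) = fderiv ℝ (fun w => m (w, v)) u X := by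
  have h := HasFDerivAt.comp (g := m) (f := fun w => (w, v)) u hm.hasFDerivAt
    (hasFDerivAt_prodMk_left u v)
  have h' := h.fderiv
  change fderiv ℝ (fun w => m (w, v)) u = _ at h'
  rw [h']
  rfl

theorem fderiv_right_apply {m : E × E → E} {u v : E} (hm : DifferentiableAt ℝ m (u, v)) (Y : E) :
    fderiv ℝ m (u, v) (0, Y) = fderiv ℝ (fun w => m (u, w)) v Y := by
  have h := hm.hasFDerivAt.comp v (hasFDerivAt_prodMk_right u v)
  have h' := h.fderiv
  change fderiv ℝ (fun w => m (u, w)) v = _ at h'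
  rw [h']
  rfl

/-- If `∂₂m(u, e) Y = ∂₁m(e, u) a(u)` for a product `m` with unit `e`, then the derivative of `a` at
`e` is the antisymmetric part of the mixed second derivative of `m`. -/
theorem fderiv_eq_sub_of_twist {m : E × E → E} {e : E} (hm : ContDiffAt ℝ 2 m (e, e))
    {a : E → E} (ha : DifferentiableAt ℝ a e)
    (htwist : ∀ᶠ u in nhds e, fderiv ℝ m (u, e) (0, a e) = fderiv ℝ m (e, u) (a u, 0))
    (hunit : ∀ Z, fderiv ℝ m (e, e) (Z, 0) = Z) (X : E) :
    fderiv ℝ a e X = fderiv ℝ (fun u => fderiv ℝ m (u, e) (0, a e)) e X -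
      fderiv ℝ (fun u => fderiv ℝ m (u, e) (0, X)) e (a e) := by
  have hD : DifferentiableAt ℝ (fderiv ℝ m) (e, e) :=
    (hm.fderiv_right (m := 1) (by norm_num)).differentiableAt (by norm_num)
  have hsymm : IsSymmSndFDerivAt ℝ m (e, e) :=
    hm.isSymmSndFDerivAt (by rw [minSmoothness_of_isRCLikeNormedField])
  have h1 : ∀ Y, HasFDerivAt (fun u => fderiv ℝ m (u, e) (0, Y))
      (((fderiv ℝ (fderiv ℝ m) (e, e)).comp (ContinuousLinearMap.inl ℝ E E)).flip (0, Y)) e := by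
    intro Y
    have h := (HasFDerivAt.comp (g := fderiv ℝ m) (f := fun u => (u, e)) e hD.hasFDerivAt
      (hasFDerivAt_prodMk_left e e)).clm_apply
      (hasFDerivAt_const ((0 : E), Y) e)
    simpa using h
  -- Differentiating both sides of the twist relation along X gives D²m[(X,0),(0,a(e))] =
  -- D²m[(0,X),(a(e),0)] + a'(e)X, by the unit property. Symmetry of D²m then puts the middle term
  -- in the required form.
  have h2 := (hD.hasFDerivAt.comp e (hasFDerivAt_prodMk_right e e)).clm_apply
    (ha.hasFDerivAt.prodMk (hasFDerivAt_const (0 : E) e))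
  have h3 := ((h1 (a e)).congr_of_eventuallyEq (htwist.mono fun u hu => hu.symm)).unique h2
  have h4 := congrArg (fun A : E →L[ℝ] E => A X) h3
  rw [(h1 (a e)).fderiv, (h1 X).fderiv]
  simp only [ContinuousLinearMap.flip_apply, ContinuousLinearMap.comp_apply,
    ContinuousLinearMap.inl_apply, add_apply, ContinuousLinearMap.inr_apply,
    ContinuousLinearMap.prod_apply, Function.comp_apply, zero_apply,
    hunit] at h4 ⊢
  rw [h4, hsymm (a e, 0) (0, X), add_sub_cancel_right]

end SecondDerivative

/-! ### The derivative of Ad is the Lie bracket. -/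

section Adjoint

variable {n : ℕ} {G : Type*} [TopologicalSpace G] [ChartedSpace (EuclideanSpace ℝ (Fin n)) G]
  [Group G] [LieGroup (𝓡 n) ∞ G]

/-- The adjoint action, with the Lie algebra unfolded to the model space. -/
def adVec (g : G) (Y : EuclideanSpace ℝ (Fin n)) : EuclideanSpace ℝ (Fin n) :=
  Ad n g (Y : LieAlg n G)

theorem vecDeriv_comp {F : Type*} [NormedAddCommGroup F] [NormedSpace ℝ F] {f : G → F} {g : G → G}
    {x : G} (hf : MDifferentiableAt (𝓡 n) 𝓘(ℝ, F) f (g x))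
    (hg : MDifferentiableAt (𝓡 n) (𝓡 n) g x) :
    vecDeriv (n := n) (fun y => f (g y)) x = (vecDeriv f (g x)).comp (rawDeriv g x) :=
  mfderiv_comp x hf hg

theorem vecDeriv_comp_conj {F : Type*} [NormedAddCommGroup F] [NormedSpace ℝ F] {f : G → F}
    (hf : MDifferentiableAt (𝓡 n) 𝓘(ℝ, F) f 1) (g : G) (Y : EuclideanSpace ℝ (Fin n)) :
    vecDeriv (n := n) (fun y => f (g * y * g⁻¹)) 1 Y = vecDeriv f 1 (adVec g Y) := by
  have h1 : g * 1 * g⁻¹ = 1 := by simp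
  have h := vecDeriv_comp (n := n) (f := f) (g := fun y => g * y * g⁻¹) (x := 1) (by rwa [h1])
    (mdifferentiableAt_conj g 1)
  rw [h, h1]
  rfl

theorem one_mem_unitChart_source : (1 : G) ∈ (unitChart n G).source := mem_extChartAt_source 1

theorem mdifferentiableAt_unitChart {x : G} (hx : x ∈ (unitChart n G).source) :
    MDifferentiableAt (𝓡 n) 𝓘(ℝ, EuclideanSpace ℝ (Fin n)) (unitChart n G) x :=
  (contMDiffAt_unitChart hx).mdifferentiableAt (by simp)

theorem vecDeriv_unitChart_one : vecDeriv (unitChart n G) (1 : G) =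
    ContinuousLinearMap.id ℝ (EuclideanSpace ℝ (Fin n)) :=
  mfderiv_extChartAt_self (I := 𝓡 n) (x := (1 : G))

/-- The derivative of the chart at 1 is the identity. The coordinate formula makes the smooth
dependence on g accessible to `contMDiffAt_fderiv_param`. -/
theorem adVec_eq_fderiv (g : G) (Y : EuclideanSpace ℝ (Fin n)) :
    adVec g Y = fderiv ℝ (fun v => unitChart n G (g * (unitChart n G).symm v * g⁻¹))
      (unitPoint n G) Y := by
  have hd := mdifferentiableAt_unitChart (n := n) (one_mem_unitChart_source (G := G))
  have h1 : g * 1 * g⁻¹ = 1 := by simp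
  have h := vecDeriv_comp_conj hd g Y
  rw [vecDeriv_unitChart_one, ContinuousLinearMap.id_apply] at h
  rw [← h, vecDeriv_one_eq]
  exact MDifferentiableAt.comp (I' := 𝓡 n) (1 : G) (by rwa [h1]) (mdifferentiableAt_conj g 1)

theorem contMDiff_adVec (Y : EuclideanSpace ℝ (Fin n)) :
    ContMDiff (𝓡 n) 𝓘(ℝ, EuclideanSpace ℝ (Fin n)) ∞ (fun g : G => adVec g Y) := by
  simp only [adVec_eq_fderiv]
  intro g
  refine ContMDiffAt.clm_apply (contMDiffAt_fderiv_param
    (Φ := fun (g : G) v => unitChart n G (g * (unitChart n G).symm v * g⁻¹)) ?_) contMDiffAt_const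
  have h1 : g * (unitChart n G).symm (unitPoint n G) * g⁻¹ = 1 := by
    rw [unitChart_symm_unitPoint]; simp
  have h2 : ContMDiffAt (𝓡 n) 𝓘(ℝ, EuclideanSpace ℝ (Fin n)) ∞ (unitChart n G)
      (g * (unitChart n G).symm (unitPoint n G) * g⁻¹) := by
    rw [h1]
    exact contMDiffAt_unitChart one_mem_unitChart_source
  exact h2.comp (g, unitPoint n G)
    (f := fun p : G × EuclideanSpace ℝ (Fin n) => p.1 * (unitChart n G).symm p.2 * p.1⁻¹)
    ((contMDiffAt_mul_unitChart_symm g unitPoint_mem).mul contMDiffAt_fst.inv)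

variable (n G) in
/-- The product of the group in the chart at the identity. -/
def chartMul (p : EuclideanSpace ℝ (Fin n) × EuclideanSpace ℝ (Fin n)) : EuclideanSpace ℝ (Fin n) :=
  unitChart n G ((unitChart n G).symm p.1 * (unitChart n G).symm p.2)

/-- A product of two chart points may leave the chart, so smoothness is claimed only where one
factor is the unit. -/
theorem contDiffAt_chartMul_left {u : EuclideanSpace ℝ (Fin n)} (hu : u ∈ (unitChart n G).target) :
    ContDiffAt ℝ ∞ (chartMul n G) (u, unitPoint n G) :=
  contDiffAt_chartMul hu unitPoint_mem (chartMul_mem_source hu)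

theorem contDiffAt_chartMul_right {u : EuclideanSpace ℝ (Fin n)}
    (hu : u ∈ (unitChart n G).target) : ContDiffAt ℝ ∞ (chartMul n G) (unitPoint n G, u) := by
  refine contDiffAt_chartMul unitPoint_mem hu ?_
  rw [unitChart_symm_unitPoint, one_mul]
  exact (unitChart n G).map_target hu

theorem fderiv_chartMul_right {u : EuclideanSpace ℝ (Fin n)} (hu : u ∈ (unitChart n G).target)
    (Y : EuclideanSpace ℝ (Fin n)) :
    fderiv ℝ (chartMul n G) (u, unitPoint n G) (0, Y) = chartField (G := G) Y u :=
  fderiv_right_apply ((contDiffAt_chartMul_left hu).differentiableAt (by simp)) Y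

theorem chartMul_unit_right {u : EuclideanSpace ℝ (Fin n)} (hu : u ∈ (unitChart n G).target) :
    chartMul n G (u, unitPoint n G) = u := by
  rw [chartMul, unitChart_symm_unitPoint, mul_one, (unitChart n G).right_inv hu]

theorem fderiv_chartMul_unit (Z : EuclideanSpace ℝ (Fin n)) :
    fderiv ℝ (chartMul n G) (unitPoint n G, unitPoint n G) (Z, 0) = Z := by
  rw [fderiv_left_apply ((contDiffAt_chartMul_left unitPoint_mem).differentiableAt (by simp))]
  have h : (fun w => chartMul n G (w, unitPoint n G)) =ᶠ[nhds (unitPoint n G)] id := by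
    filter_upwards [isOpen_unitChart_target.mem_nhds unitPoint_mem] with u hu
    exact chartMul_unit_right hu
  rw [h.fderiv_eq, fderiv_id]
  rfl

theorem chartField_unit (Z : EuclideanSpace ℝ (Fin n)) :
    chartField (G := G) Z (unitPoint n G) = Z := by
  rw [chartField]
  have h : (fun v => unitChart n G ((unitChart n G).symm (unitPoint n G) *
      (unitChart n G).symm v)) =ᶠ[nhds (unitPoint n G)] id := by
    filter_upwards [isOpen_unitChart_target.mem_nhds unitPoint_mem] with u hu
    rw [unitChart_symm_unitPoint, one_mul, (unitChart n G).right_inv hu]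
    rfl
  rw [h.fderiv_eq, fderiv_id]
  rfl

/-- Left translation is conjugation followed by right translation, in the chart. -/
theorem chartField_eq_fderiv_adVec {u : EuclideanSpace ℝ (Fin n)}
    (hu : u ∈ (unitChart n G).target) (Y : EuclideanSpace ℝ (Fin n)) :
    chartField (G := G) Y u = fderiv ℝ (chartMul n G) (unitPoint n G, u)
      (adVec ((unitChart n G).symm u) Y, 0) := by
  rw [fderiv_left_apply ((contDiffAt_chartMul_right hu).differentiableAt (by simp))]
  set g := (unitChart n G).symm u with hg
  have hgs : g ∈ (unitChart n G).source := (unitChart n G).map_target hu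
  have hL : MDifferentiableAt (𝓡 n) 𝓘(ℝ, EuclideanSpace ℝ (Fin n))
      (fun y => unitChart n G (g * y)) 1 :=
    MDifferentiableAt.comp (I' := 𝓡 n) (1 : G)
      (mdifferentiableAt_unitChart (by simpa using hgs)) (mdifferentiableAt_mulLeft g 1)
  have hR : MDifferentiableAt (𝓡 n) 𝓘(ℝ, EuclideanSpace ℝ (Fin n))
      (fun y => unitChart n G (y * g)) 1 :=
    MDifferentiableAt.comp (I' := 𝓡 n) (1 : G)
      (mdifferentiableAt_unitChart (by simpa using hgs))
      ((contMDiff_mul_right (I := 𝓡 n) (n := ∞) (a := g)).mdifferentiableAt (by simp))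
  have h1 : chartField (G := G) Y u = vecDeriv (fun y => unitChart n G (g * y)) 1 Y := by
    rw [vecDeriv_one_eq hL]
    rfl
  have h2 : (fun y => unitChart n G (g * y)) = fun y => unitChart n G (g * y * g⁻¹ * g) := by
    funext y; simp
  rw [h1, h2, vecDeriv_comp_conj (f := fun y => unitChart n G (y * g)) hR, vecDeriv_one_eq hR]
  rfl

/-- The pullback of a left-invariant vector field to the chart at the identity. -/
def pulledField (X : LieAlg n G) : EuclideanSpace ℝ (Fin n) → EuclideanSpace ℝ (Fin n) :=
  VectorField.mpullbackWithin 𝓘(ℝ, EuclideanSpace ℝ (Fin n)) (𝓡 n) (unitChart n G).symm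
    (mulInvariantVectorField X) (Set.range (𝓡 n))

/-- The bracket of 𝔤 is defined through the pulled-back field on the left. The derivatives of the
chart and of its inverse are mutually inverse, so it may be computed with `chartField`. -/
theorem pulledField_eq (X : EuclideanSpace ℝ (Fin n)) {u : EuclideanSpace ℝ (Fin n)}
    (hu : u ∈ (unitChart n G).target) :
    pulledField (G := G) X u = chartField (G := G) X u := by
  have hgs : (unitChart n G).symm u ∈ (unitChart n G).source := (unitChart n G).map_target hu
  have h := vecDeriv_unitChart_leftField X hgs
  rw [(unitChart n G).right_inv hu] at h
  rw [← h]
  exact congrArg (fun A : EuclideanSpace ℝ (Fin n) →L[ℝ] EuclideanSpace ℝ (Fin n) =>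
      A (leftField X ((unitChart n G).symm u)))
    (ContinuousLinearMap.inverse_eq (mfderivWithin_extChartAt_symm_comp_mfderiv_extChartAt hu)
      (mfderiv_extChartAt_comp_mfderivWithin_extChartAt_symm hu))

/-- The Lie bracket of `𝔤`, with the Lie algebra unfolded to the model space. -/
def lieVec (X Y : LieAlg n G) : EuclideanSpace ℝ (Fin n) := (⁅X, Y⁆ : LieAlg n G)

/-- The Lie bracket of `𝔤` in the chart at the identity. -/
theorem bracket_eq_fderiv_chartField (X Y : EuclideanSpace ℝ (Fin n)) :
    lieVec (G := G) X Y =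
      fderiv ℝ (chartField (G := G) Y) (unitPoint n G) X -
        fderiv ℝ (chartField (G := G) X) (unitPoint n G) Y := by
  have hev : ∀ Z : EuclideanSpace ℝ (Fin n),
      pulledField (G := G) Z =ᶠ[nhds (unitPoint n G)] chartField (G := G) Z := by
    intro Z
    filter_upwards [isOpen_unitChart_target.mem_nhds unitPoint_mem] with u hu
    exact pulledField_eq Z hu
  have h1 : lieVec (G := G) X Y =
      (vecDeriv (unitChart n G) (1 : G)).inverse (VectorField.lieBracketWithin ℝ
        (pulledField (G := G) X) (pulledField (G := G) Y)
        ((unitChart n G).symm ⁻¹' Set.univ ∩ Set.range (𝓡 n)) (unitPoint n G)) := rfl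
  have h2 : (unitChart n G).symm ⁻¹' Set.univ ∩ Set.range (𝓡 n) = Set.univ := by simp
  rw [h1, h2, VectorField.lieBracketWithin_univ, vecDeriv_unitChart_one,
    ContinuousLinearMap.inverse_id, ContinuousLinearMap.id_apply,
    (hev X).lieBracket_vectorField_eq (hev Y), VectorField.lieBracket_eq]
  simp only [chartField_unit]

/-- The derivative of the adjoint action is the Lie bracket. -/
theorem vecDeriv_adVec (X Y : EuclideanSpace ℝ (Fin n)) :
    vecDeriv (fun g : G => adVec g Y) 1 X = lieVec (G := G) X Y := by
  have hY : adVec (1 : G) Y = Y := LinearMap.congr_fun (Ad_one (n := n) (G := G)) Y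
  have hd : DifferentiableAt ℝ (fun u => adVec ((unitChart n G).symm u) Y) (unitPoint n G) :=
    (contMDiffAt_iff_contDiffAt.1 (((contMDiff_adVec Y) _).comp (unitPoint n G)
      (contMDiffAt_unitChart_symm unitPoint_mem))).differentiableAt (by simp)
  have hcf : ∀ Z : EuclideanSpace ℝ (Fin n),
      (fun u => fderiv ℝ (chartMul n G) (u, unitPoint n G) (0, Z)) =ᶠ[nhds (unitPoint n G)]
        chartField (G := G) Z := by
    intro Z
    filter_upwards [isOpen_unitChart_target.mem_nhds unitPoint_mem] with u hu
    exact fderiv_chartMul_right hu Z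
  -- Here a(u) is Ad Y at the point with coordinates u, and the twist relation is the derivative of
  -- gy = (gyg⁻¹)g at y = 1. The result is the coordinate formula for the bracket.
  have h := fderiv_eq_sub_of_twist (m := chartMul n G) (e := unitPoint n G)
    ((contDiffAt_chartMul_left unitPoint_mem).of_le ENat.LEInfty.out) hd (by
      filter_upwards [isOpen_unitChart_target.mem_nhds unitPoint_mem] with u hu
      rw [fderiv_chartMul_right hu, unitChart_symm_unitPoint, hY]
      exact chartField_eq_fderiv_adVec hu Y) fderiv_chartMul_unit X
  rw [vecDeriv_one_eq ((contMDiff_adVec Y).mdifferentiableAt (by simp)), h,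
    unitChart_symm_unitPoint, hY, (hcf Y).fderiv_eq, (hcf X).fderiv_eq]
  exact (bracket_eq_fderiv_chartField X Y).symm

end Adjoint

/-! ### Duality for positive definite forms and the sign of the Killing form. -/

section Representation

variable {V : Type*} [AddCommGroup V] [Module ℝ V] [FiniteDimensional ℝ V]

/-- A positive definite form is injective as a map to the dual, hence an isomorphism by dimension.
-/
theorem exists_operator_of_bilinForm (B : LinearMap.BilinForm ℝ V)
    (hp : ∀ x, x ≠ 0 → 0 < B x x) (C : LinearMap.BilinForm ℝ V) :
    ∃ Γ : V →ₗ[ℝ] V, ∀ x y, C x y = B (Γ x) y := by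
  have hinj : Function.Injective B := by
    rw [injective_iff_map_eq_zero]
    intro x hx
    by_contra hne
    have := hp x hne
    rw [hx] at this
    exact lt_irrefl _ this
  let e : V ≃ₗ[ℝ] Module.Dual ℝ V :=
    LinearEquiv.ofInjectiveOfFinrankEq B hinj Subspace.dual_finrank_eq.symm
  refine ⟨e.symm.toLinearMap ∘ₗ C, fun x y => ?_⟩
  exact (LinearMap.congr_fun (e.apply_symm_apply (C x)) y).symm

/-- A functional that vanishes on a set and on its orthogonal complement vanishes. -/
theorem dual_eq_zero_of_vanish (B : LinearMap.BilinForm ℝ V) (hs : ∀ x y, B x y = B y x)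
    (hp : ∀ x, x ≠ 0 → 0 < B x x) (ℓ : Module.Dual ℝ V) (S : Set V) (hS : ∀ y ∈ S, ℓ y = 0)
    (hS' : ∀ x, (∀ y ∈ S, B y x = 0) → ℓ x = 0) : ℓ = 0 := by
  -- Γx is ℓ(x) times the vector that represents ℓ. It is orthogonal to S, so ℓ(Γx) = 0, hence B(Γx,
  -- Γx) = 0, and finally ℓ(x)² = 0.
  obtain ⟨Γ, hΓ⟩ := exists_operator_of_bilinForm B hp (LinearMap.smulRight ℓ ℓ)
  by_contra hne
  obtain ⟨x, hx⟩ : ∃ x, ℓ x ≠ 0 := by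
    by_contra! hall
    exact hne (LinearMap.ext hall)
  have h1 : ∀ y, B (Γ x) y = ℓ x * ℓ y := fun y => by rw [← hΓ]; simp
  have h2 : ℓ (Γ x) = 0 := hS' _ fun y hy => by rw [hs, h1, hS y hy, mul_zero]
  have h3 : Γ x = 0 := by
    by_contra h0
    have := hp _ h0
    rw [h1, h2, mul_zero] at this
    exact lt_irrefl _ this
  have h4 := h1 x
  rw [h3, map_zero, LinearMap.zero_apply] at h4
  exact hx (mul_self_eq_zero.1 h4.symm)

variable {L : Type*} [LieRing L] [LieAlgebra ℝ L] [FiniteDimensional ℝ L]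

/-- S is an arbitrary set because 𝔨 enters as the set `subgroupLieAlg`; its linear structure is
never needed. -/
theorem dual_lie_eq_zero_of_vanish (B : LinearMap.BilinForm ℝ L) (hs : ∀ x y, B x y = B y x)
    (hp : ∀ x, x ≠ 0 → 0 < B x x) (μ : Module.Dual ℝ L) (X : L) (S : Set L)
    (hS : ∀ y ∈ S, μ ⁅X, y⁆ = 0) (hS' : ∀ x, (∀ y ∈ S, B y x = 0) → μ ⁅X, x⁆ = 0) (Y : L) :
    μ ⁅X, Y⁆ = 0 :=
  LinearMap.congr_fun (dual_eq_zero_of_vanish B hs hp (μ ∘ₗ LieAlgebra.ad ℝ L X) S hS hS') Y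

/-- The Killing form of a semisimple Lie algebra with an invariant inner product is negative. -/
theorem killingForm_neg_of_invariant [LieAlgebra.IsSemisimple ℝ L] (B : LinearMap.BilinForm ℝ L)
    (hs : ∀ x y, B x y = B y x) (hp : ∀ x, x ≠ 0 → 0 < B x x)
    (hinv : ∀ x y z : L, B ⁅x, y⁆ z = -B y ⁅x, z⁆) (x : L) (hx : x ≠ 0) :
    killingForm ℝ L x x < 0 := by
  rw [killingForm_apply_apply]
  refine trace_comp_self_neg_of_skew B hs hp _ (hinv x) fun h => hx ?_
  -- The adjoint representation of a semisimple Lie algebra is faithful, so ad x = 0 forces x = 0.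
  exact LieModule.ext_of_isFaithful (R := ℝ) (M := L) (fun m => by
    rw [zero_lie]; exact LinearMap.congr_fun h m)

end Representation

/-! ### Averaged inner product and positivity of `Kil`. -/

section Killing

variable {n : ℕ} {G : Type*} [TopologicalSpace G] [ChartedSpace (EuclideanSpace ℝ (Fin n)) G]
  [Group G] [LieGroup (𝓡 n) ∞ G]

theorem adVec_mul (x y : G) (X : EuclideanSpace ℝ (Fin n)) :
    adVec (x * y) X = adVec x (adVec y X) := LinearMap.congr_fun (Ad_mul (n := n) x y) X

theorem adVec_one (X : EuclideanSpace ℝ (Fin n)) : adVec (1 : G) X = X :=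
  LinearMap.congr_fun (Ad_one (n := n) (G := G)) X

theorem adVec_add (g : G) (X Y : EuclideanSpace ℝ (Fin n)) :
    adVec g (X + Y) = adVec g X + adVec g Y := map_add (Ad n g) _ _

theorem adVec_smul (g : G) (r : ℝ) (X : EuclideanSpace ℝ (Fin n)) :
    adVec g (r • X) = r • adVec g X := map_smul (Ad n g) _ _

/-- The velocity of the adjoint action along a curve. -/
theorem hasDerivAt_adVec_curve {γ : ℝ → G} (hγ : ContMDiff 𝓘(ℝ, ℝ) (𝓡 n) ∞ γ) (h1 : γ 0 = 1)
    {X : EuclideanSpace ℝ (Fin n)}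
    (hX : (mfderiv 𝓘(ℝ, ℝ) (𝓡 n) γ 0 (1 : ℝ) : EuclideanSpace ℝ (Fin n)) = X)
    (Y : EuclideanSpace ℝ (Fin n)) :
    HasDerivAt (fun t => adVec (γ t) Y) (lieVec (G := G) X Y) 0 := by
  have h := hasDerivAt_comp_curve ((contMDiff_adVec (G := G) Y).mdifferentiableAt (by simp)) hγ h1 hX
  rwa [vecDeriv_adVec] at h

/-- The average over `G` of the translates of an inner product on `𝔤`. -/
def averagedForm [CompactSpace G] [MeasurableSpace G] [BorelSpace G] (ν : Measure G)
    [ν.IsHaarMeasure] : LinearMap.BilinForm ℝ (EuclideanSpace ℝ (Fin n)) :=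
  have hint : ∀ X Y : EuclideanSpace ℝ (Fin n),
      Integrable (fun g : G => (inner ℝ (adVec g X) (adVec g Y) : ℝ)) ν := fun X Y =>
    ((contMDiff_adVec X).continuous.inner
      (contMDiff_adVec Y).continuous).integrable_of_hasCompactSupport
        (HasCompactSupport.of_compactSpace _)
  LinearMap.mk₂ ℝ (fun X Y => ∫ g : G, (inner ℝ (adVec g X) (adVec g Y) : ℝ) ∂ν)
    (fun X X' Y => by
      simp only [adVec_add, inner_add_left]
      exact integral_add (hint _ _) (hint _ _))
    (fun r X Y => by
      simp only [adVec_smul, real_inner_smul_left]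
      exact integral_const_mul _ _)
    (fun X Y Y' => by
      simp only [adVec_add, inner_add_right]
      exact integral_add (hint _ _) (hint _ _))
    (fun r X Y => by
      simp only [adVec_smul, real_inner_smul_right]
      exact integral_const_mul _ _)

section

variable [CompactSpace G] [MeasurableSpace G] [BorelSpace G] (ν : Measure G) [ν.IsHaarMeasure]

theorem averagedForm_apply (X Y : EuclideanSpace ℝ (Fin n)) :
    averagedForm ν X Y = ∫ g : G, (inner ℝ (adVec g X) (adVec g Y) : ℝ) ∂ν := rfl

theorem averagedForm_symm (X Y : EuclideanSpace ℝ (Fin n)) :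
    averagedForm ν X Y = averagedForm ν Y X := by
  simp only [averagedForm_apply, real_inner_comm]

theorem averagedForm_pos (X : EuclideanSpace ℝ (Fin n)) (hX : X ≠ 0) :
    0 < averagedForm ν X X := by
  rw [averagedForm_apply]
  refine Continuous.integral_pos_of_hasCompactSupport_nonneg_nonzero (x := (1 : G))
    ((contMDiff_adVec X).continuous.inner (contMDiff_adVec X).continuous)
    (HasCompactSupport.of_compactSpace _) (fun g => real_inner_self_nonneg) ?_
  rw [adVec_one]
  exact (real_inner_self_pos.2 hX).ne'

/-- Ad_g Ad_x = Ad_{gx}, so right-invariance of ν absorbs x. -/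
theorem averagedForm_adVec (x : G) (X Y : EuclideanSpace ℝ (Fin n)) :
    averagedForm ν (adVec x X) (adVec x Y) = averagedForm ν X Y := by
  have : IsTopologicalGroup G := topologicalGroup_of_lieGroup (𝓡 n) ∞
  have : ν.IsMulRightInvariant := isMulRightInvariant_of_compactSpace ν
  simp only [averagedForm_apply, ← adVec_mul]
  exact integral_mul_right_eq_self (μ := ν)
    (fun g : G => (inner ℝ (adVec g X) (adVec g Y) : ℝ)) x

/-- Derivative at 0 of the Ad-invariance along the one-parameter subgroup of X. -/
theorem averagedForm_lieVec [T2Space G] (X Y Z : EuclideanSpace ℝ (Fin n)) :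
    averagedForm ν (lieVec (G := G) X Y) Z = -averagedForm ν Y (lieVec (G := G) X Z) := by
  obtain ⟨γ, hγ, hmul, hX⟩ := exists_oneParameter (G := G) X
  have h1 : γ 0 = 1 := by simpa using hmul 0 0
  let B := (averagedForm (n := n) ν).toContinuousBilinearMap
  have hY := hasDerivAt_adVec_curve hγ h1 hX Y
  have hZ := hasDerivAt_adVec_curve hγ h1 hX Z
  have h2 := (B.hasFDerivAt.comp_hasDerivAt (0 : ℝ) hY).clm_apply hZ
  have h3 : (fun t => (B ∘ fun t => adVec (γ t) Y) t (adVec (γ t) Z)) =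
      fun _ => averagedForm ν Y Z := by
    funext t
    exact averagedForm_adVec ν (γ t) Y Z
  rw [h3] at h2
  have h4 := h2.unique (hasDerivAt_const _ _)
  simp only [Function.comp_apply, h1, adVec_one] at h4
  exact eq_neg_of_add_eq_zero_left h4

end

theorem Kil_symm (X Y : LieAlg n G) : Kil n G X Y = Kil n G Y X :=
  congrArg Neg.neg (LieModule.traceForm_comm ℝ (LieAlg n G) (LieAlg n G) X Y)

/-- On a compact semisimple Lie group, the negative of the Killing form is positive definite. -/
theorem Kil_pos [CompactSpace G] [T2Space G] [LieAlgebra.IsSemisimple ℝ (LieAlg n G)]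
    [MeasurableSpace G] [BorelSpace G] (ν : Measure G) [ν.IsHaarMeasure] (X : LieAlg n G)
    (hX : X ≠ 0) : 0 < Kil n G X X := by
  have h1 := killingForm_neg_of_invariant (L := LieAlg n G) (averagedForm (n := n) ν)
    (averagedForm_symm ν) (averagedForm_pos ν) (averagedForm_lieVec ν) X hX
  exact neg_pos.2 h1

end Killing

/-! ### The almost-Hermitian structure of a coadjoint orbit. -/

section CoadjointOrbit

variable {n : ℕ} {G : Type*} [TopologicalSpace G] [ChartedSpace (EuclideanSpace ℝ (Fin n)) G]
  [Group G] [LieGroup (𝓡 n) ∞ G] (μ : Module.Dual ℝ (LieAlg n G))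

theorem mem_coadjointStabilizer_iff {x : G} :
    x ∈ coadjointStabilizer μ ↔ ∀ Y, μ (Ad n x Y) = μ Y := by
  rw [← inv_mem_iff]
  change μ ∘ₗ Ad n x⁻¹⁻¹ = μ ↔ _
  rw [inv_inv]
  exact LinearMap.ext_iff

/-- A linear form on `𝔤`, with the Lie algebra unfolded to the model space. -/
def dualVec : EuclideanSpace ℝ (Fin n) →L[ℝ] ℝ :=
  LinearMap.toContinuousLinearMap (μ : EuclideanSpace ℝ (Fin n) →ₗ[ℝ] ℝ)

/-- Along a one-parameter subgroup γ of the stabilizer, μ(Ad_γ(t) X) is constant; its derivative at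
0 is μ([Y, X]). -/
theorem dual_lie_eq_zero {Y : LieAlg n G} (hY : Y ∈ subgroupLieAlg n (coadjointStabilizer μ))
    (X : LieAlg n G) : μ ⁅Y, X⁆ = 0 := by
  obtain ⟨γ, hγ, hmul, hK, hd⟩ := hY
  have h1 : γ 0 = 1 := by simpa using hmul 0 0
  have h2 := (dualVec μ).hasFDerivAt.comp_hasDerivAt (0 : ℝ) (hasDerivAt_adVec_curve hγ h1 hd X)
  have h3 : (dualVec μ ∘ fun t => adVec (γ t) X) = fun _ => μ X := by
    funext t
    exact (mem_coadjointStabilizer_iff μ).1 (hK t) X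
  rw [h3] at h2
  exact h2.unique (hasDerivAt_const _ _)

theorem mem_subgroupLieAlg_coadjointStabilizer [T2Space G] {X : LieAlg n G}
    (hX : ∀ Y, μ ⁅X, Y⁆ = 0) : X ∈ subgroupLieAlg n (coadjointStabilizer μ) := by
  obtain ⟨γ, hγ, hmul, hd⟩ := exists_oneParameter (G := G) X
  have h1 : γ 0 = 1 := by simpa using hmul 0 0
  refine ⟨γ, hγ, hmul, fun t => ?_, hd⟩
  rw [mem_coadjointStabilizer_iff]
  intro (Y : EuclideanSpace ℝ (Fin n))
  -- From γ(r) = γ(r - t) γ(t), the derivative at t is μ([X, Ad_γ(t) Y]), which vanishes by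
  -- hypothesis.
  have hder : ∀ t : ℝ, HasDerivAt (fun t => dualVec μ (adVec (γ t) Y)) 0 t := by
    intro t
    have h2 := (dualVec μ).hasFDerivAt.comp_hasDerivAt (0 : ℝ)
      (hasDerivAt_adVec_curve hγ h1 hd (adVec (γ t) Y))
    have h3 : dualVec μ (lieVec (G := G) X (adVec (γ t) Y)) = 0 := hX (adVec (γ t) Y)
    rw [h3] at h2
    have h4 : HasDerivAt (fun r : ℝ => r - t) 1 t := (hasDerivAt_id t).sub_const t
    have h5 := HasDerivAt.scomp (g₁ := dualVec μ ∘ fun s => adVec (γ s) (adVec (γ t) Y)) t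
      (by simpa using h2) h4
    rw [smul_zero] at h5
    refine h5.congr_of_eventuallyEq (Filter.Eventually.of_forall fun r => ?_)
    simp only [Function.comp_apply, ← adVec_mul, ← hmul, sub_add_cancel]
  have h6 := is_const_of_deriv_eq_zero (fun t => (hder t).differentiableAt)
    (fun t => (hder t).deriv) t 0
  simp only [h1, adVec_one] at h6
  exact h6

variable {μ}

/-- The form `μ([X, Y])` on `𝔪`. -/
def orbitForm (μ : Module.Dual ℝ (LieAlg n G)) :
    LinearMap.BilinForm ℝ (tangentM n (coadjointStabilizer μ)) :=
  LinearMap.mk₂ ℝ (fun X Y => μ ⁅(X : LieAlg n G), (Y : LieAlg n G)⁆)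
    (fun X X' Y => by simp) (fun r X Y => by simp) (fun X Y Y' => by simp) (fun r X Y => by simp)

theorem orbitForm_apply (X Y : tangentM n (coadjointStabilizer μ)) :
    orbitForm μ X Y = μ ⁅(X : LieAlg n G), (Y : LieAlg n G)⁆ := rfl

theorem orbitForm_AdM (s : coadjointStabilizer μ) (X Y : tangentM n (coadjointStabilizer μ)) :
    orbitForm μ (AdM s X) (AdM s Y) = orbitForm μ X Y := by
  have h := (mem_coadjointStabilizer_iff μ).1 s.2 ⁅(X : LieAlg n G), (Y : LieAlg n G)⁆
  rw [Ad_lie] at h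
  exact h

variable (μ) in
/-- The restriction of `Kil` to `𝔪`. -/
def orbitMetric : LinearMap.BilinForm ℝ (tangentM n (coadjointStabilizer μ)) :=
  (Kil n G).compl₁₂ (tangentM n _).subtype (tangentM n _).subtype

theorem orbitMetric_apply (X Y : tangentM n (coadjointStabilizer μ)) :
    orbitMetric μ X Y = Kil n G X Y := rfl

theorem orbitMetric_AdM (s : coadjointStabilizer μ) (X Y : tangentM n (coadjointStabilizer μ)) :
    orbitMetric μ (AdM s X) (AdM s Y) = orbitMetric μ X Y := by
  have h : ∀ Z : tangentM n (coadjointStabilizer μ),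
      ((AdM s Z : tangentM n (coadjointStabilizer μ)) : LieAlg n G) = Ad n (s : G) Z := fun _ => rfl
  rw [orbitMetric_apply, orbitMetric_apply, h, h, Kil_Ad]

/-- The form `μ([X, Y])` is nondegenerate on `𝔪`. -/
theorem eq_zero_of_orbitForm_eq_zero [T2Space G]
    (hpos : ∀ X : LieAlg n G, X ≠ 0 → 0 < Kil n G X X)
    {X : tangentM n (coadjointStabilizer μ)} (hX : ∀ Y, orbitForm μ X Y = 0) : X = 0 := by
  -- μ([X, ·]) vanishes on 𝔨 and on 𝔪 = 𝔨^⊥, hence everywhere. So X lies in 𝔨 as well as in 𝔨^⊥, and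
  -- Kil(X, X) = 0.
  have h1 := dual_lie_eq_zero_of_vanish (Kil n G) Kil_symm hpos μ (X : LieAlg n G)
    (subgroupLieAlg n (coadjointStabilizer μ))
    (fun Y hY => by
      have := dual_lie_eq_zero μ hY (X : LieAlg n G)
      rwa [← lie_skew, map_neg, neg_eq_zero] at this)
    (fun Y hY => hX ⟨Y, hY⟩)
  have h2 : (X : LieAlg n G) ∈ subgroupLieAlg n (coadjointStabilizer μ) :=
    mem_subgroupLieAlg_coadjointStabilizer μ h1
  by_contra h0
  have h3 := hpos (X : LieAlg n G) fun h => h0 (Subtype.ext h)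
  rw [X.2 _ h2] at h3
  exact lt_irrefl _ h3

/-- The canonical almost-Hermitian structure of a coadjoint orbit with the Killing-form metric. -/
theorem exists_almostHermitian_coadjoint [T2Space G]
    (hpos : ∀ X : LieAlg n G, X ≠ 0 → 0 < Kil n G X X) (μ : Module.Dual ℝ (LieAlg n G)) :
    ∃ h : AlmostHermitian n (coadjointStabilizer μ),
      (∀ X Y, h.g₀ X Y = Kil n G X Y) ∧ IsPolarFactor μ h.J := by
  have hsymm : ∀ X Y, orbitMetric μ X Y = orbitMetric μ Y X := fun X Y => Kil_symm _ _
  have hp : ∀ X, X ≠ 0 → 0 < orbitMetric μ X X := fun X hX =>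
    hpos X fun h => hX (Subtype.ext h)
  obtain ⟨Γ, hΓ⟩ := exists_operator_of_bilinForm (orbitMetric μ) hp (orbitForm μ)
  have hskew : ∀ X Y, orbitMetric μ (Γ X) Y = -orbitMetric μ X (Γ Y) := by
    intro X Y
    rw [← hΓ, hsymm X, ← hΓ, orbitForm_apply, orbitForm_apply, ← lie_skew, map_neg]
  have hinj : Function.Injective Γ := by
    rw [injective_iff_map_eq_zero]
    intro X hX
    exact eq_zero_of_orbitForm_eq_zero hpos fun Y => by rw [hΓ, hX, map_zero, LinearMap.zero_apply]
  have hcomm : ∀ (s : coadjointStabilizer μ) X, Γ (AdM s X) = AdM s (Γ X) := by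
    intro s X
    have h1 : ∀ Y, orbitMetric μ (Γ (AdM s X) - AdM s (Γ X)) Y = 0 := by
      intro Y
      -- Testing against Ad_s Z turns both Γ Ad_s X and Ad_s Γ X into μ([X, Z]), by invariance of
      -- the form and of the metric.
      obtain ⟨Z, rfl⟩ : ∃ Z, Y = AdM s Z :=
        ⟨AdM s⁻¹ Y, Subtype.ext (Ad_Ad_inv (s : G) (Y : LieAlg n G)).symm⟩
      rw [map_sub, LinearMap.sub_apply, ← hΓ, orbitForm_AdM, orbitMetric_AdM, hΓ, sub_self]
    by_contra hne
    exact (hp _ (sub_ne_zero.2 hne)).ne' (h1 _)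
  obtain ⟨A, J, hA, hApos, hAJ, hJJ, hJ, hJR⟩ :=
    exists_polar_of_skew (orbitMetric μ) hsymm hp Γ hskew hinj
  refine ⟨⟨orbitMetric μ, hsymm, hp, orbitMetric_AdM, J, hJJ, hJ,
    fun s X => hJR (AdM s) (hcomm s) X⟩, fun X Y => rfl, A, hA, hApos, fun X Y => ?_⟩
  rw [hAJ]
  exact hΓ X Y

end CoadjointOrbit

end HomogeneousDirac
end

open HomogeneousDirac in
/-- Let `G` be a compact semisimple Lie group with a Haar measure `ν`. For every closed subgroup `K`
and every homogeneous almost-Hermitian structure `h = (g₀, J)` on `G/K`, the canonical connection is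
a connection on the tangent bundle of `G/K` that is compatible with `g₀` and commutes with `J`, and
for every character `χ` of `K` its Dirac operator is a formally self-adjoint operator on
`𝒮(G/K, χ)`. In particular, this holds for every coadjoint orbit, with the metric that is the
restriction of `Kil` to `𝔪` and its canonical complex structure. -/
theorem corollary7p5 {n : ℕ} {G : Type*} [TopologicalSpace G]
    [ChartedSpace (EuclideanSpace ℝ (Fin n)) G] [Group G] [LieGroup (𝓡 n) ∞ G]
    [CompactSpace G] [T2Space G] [LieAlgebra.IsSemisimple ℝ (LieAlg n G)]
    [MeasurableSpace G] [BorelSpace G] (ν : Measure G) [ν.IsHaarMeasure] :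
    (∀ K : Subgroup G, IsClosed (K : Set G) → ∀ h : AlmostHermitian n K,
      (∀ V ∈ h.vectorFields, ∀ W ∈ h.vectorFields, h.canonicalConnection V W ∈ h.vectorFields) ∧
      h.CompatibleWithMetric h.canonicalConnection ∧
      h.CommutesWithJ h.canonicalConnection ∧
      ∀ χ : K →ₜ* Circle,
        (∀ ψ ∈ h.spinorFields χ, h.dirac ψ ∈ h.spinorFields χ) ∧
        h.FormallySelfAdjoint ν χ h.dirac) ∧
    (∀ μ : Module.Dual ℝ (LieAlg n G), ∃ h : AlmostHermitian n (coadjointStabilizer μ),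
      (∀ X Y, h.g₀ X Y = Kil n G X Y) ∧ IsPolarFactor μ h.J ∧
      ∀ χ : coadjointStabilizer μ →ₜ* Circle,
        (∀ ψ ∈ h.spinorFields χ, h.dirac ψ ∈ h.spinorFields χ) ∧
        h.FormallySelfAdjoint ν χ h.dirac) := by
  have key : ∀ (K : Subgroup G) (h : AlmostHermitian n K) (χ : K →ₜ* Circle),
      (∀ ψ ∈ h.spinorFields χ, h.dirac ψ ∈ h.spinorFields χ) ∧
        h.FormallySelfAdjoint ν χ h.dirac := fun K h χ =>
    ⟨fun ψ hψ => h.dirac_mem_spinorFields hψ, h.formallySelfAdjoint_dirac ν⟩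
  refine ⟨fun K _ h => ⟨fun V hV W hW => h.canonicalConnection_mem hV hW,
    h.compatibleWithMetric_canonicalConnection, h.commutesWithJ_canonicalConnection, key K h⟩,
    fun μ => ?_⟩
  obtain ⟨h, hg, hJ⟩ := exists_almostHermitian_coadjoint (Kil_pos ν) μ
  exact ⟨h, hg, hJ, key _ h⟩
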